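/- For integers $n,m$ with $0\le m\le\binom n2$ let $G(n,m)$ be the uniformly random (simple) graph on the vertex set $V=\{1,\dots,n\}$ with exactly $m$ edges. For a fixed integer $k$ and a fixed real $d>0$ put $m=\lceil dn/2\rceil$; an event holds w.h.p. if its probability tends to $1$ as $n\to\infty$ with $k,d$ fixed. Let $G=(V,E)$ be a graph and $\zeta:V\to\{0,1,\dots,k\}$. A vertex $v$ is stable under $\zeta$ if $\zeta(v)\ne0$ and for every $j\in\{1,\dots,k\}\setminus\{\zeta(v)\}$ there are at least two distinct neighbors $u_1,u_2$ of $v$ with $\zeta(u_1)=\zeta(u_2)=j$. The map $\zeta$ is a $k$-cover in $G$ if (CV1) no edge $\{u,v\}$ satisfies $\zeta(u)=\zeta(v)\neq0$; (CV2) every $v$ with $\zeta(v)\ne0$ is stable under $\zeta$; (CV3) for every $v$ with $\zeta(v)=0$ there are distinct $i,j\in\{1,\dots,k\}$ such that $v$ has no neighbor $u$ with $\zeta(u)=i$ and at most one neighbor $w$ with $\zeta(w)=j$. **Proposition.** There is a sequence $(\varepsilon_k)_k$ of reals with $\varepsilon_k\to0$ as $k\to\infty$ such that the following holds. For every sequence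 $(\delta_k)_k$ of reals with $\delta_k\to0$ there is $k_0$ such that for every $k\ge k_0$ and every real $$d\ \ge\ 2k\ln k-\ln k-1+\varepsilon_k,$$ w.h.p. the random graph $G(n,m)$, $m=\lceil dn/2\rceil$, does not have a $k$-cover $\zeta$ with all of the following three properties: 1. $|\zeta^{-1}(0)|\le n k^{-2/3}$; 2. $\bigl||\zeta^{-1}(i)|-n/k\bigr|\le\delta_k\, n/k$ for all $i\in\{1,\dots,k\}$; 3. there are no more than $\ln^9k$ indices $i\in\{1,\dots,k\}$ such that $\bigl||\zeta^{-1}(i)|-n/k\bigr|>n/(k\ln^3k)$. -/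

import Mathlib

open Filter Topology

namespace ColorCover

/-- `v` is stable under `ζ : V → {0, 1, …, k}`: its color is nonzero, and each color `j ∈ {1, …, k}`
other than `ζ v` appears on at least two distinct neighbors of `v`. The color `0` is the joker. -/
def IsStable {V : Type*} (G : SimpleGraph V) {k : ℕ} (ζ : V → Fin (k + 1)) (v : V) : Prop :=
  ζ v ≠ 0 ∧ ∀ j : Fin (k + 1), j ≠ 0 → j ≠ ζ v →
    ∃ u₁ u₂ : V, u₁ ≠ u₂ ∧ G.Adj v u₁ ∧ G.Adj v u₂ ∧ ζ u₁ = j ∧ ζ u₂ = j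

/-- The map `ζ : V → {0, 1, …, k}` is a `k`-cover in `G`. -/
structure IsCover {V : Type*} (G : SimpleGraph V) {k : ℕ} (ζ : V → Fin (k + 1)) : Prop where
  /-- No edge joins two vertices of the same nonzero color. -/
  proper : ∀ u v : V, G.Adj u v → ¬ (ζ u = ζ v ∧ ζ v ≠ 0)
  /-- Every vertex of nonzero color is stable. -/
  stable : ∀ v : V, ζ v ≠ 0 → IsStable G ζ v
  /-- For a vertex of color `0` there are distinct colors `i, j ∈ {1, …, k}` such that it has no
  neighbor of color `i` and at most one neighbor of color `j`. -/
  joker : ∀ v : V, ζ v = 0 → ∃ i j : Fin (k + 1), i ≠ 0 ∧ j ≠ 0 ∧ i ≠ j ∧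
    (∀ u : V, G.Adj v u → ζ u ≠ i) ∧
    (∀ w w' : V, G.Adj v w → G.Adj v w' → ζ w = j → ζ w' = j → w = w')

/-- The number of vertices that receive color `i`. -/
noncomputable def classSize {n k : ℕ} (ζ : Fin n → Fin (k + 1)) (i : Fin (k + 1)) : ℕ :=
  Set.ncard {v : Fin n | ζ v = i}

/-- The three size conditions on the color classes: at most `n k ^ (-2/3)` vertices have color `0`;
every other class has size within `δ n / k` of `n / k`; and at most `(ln k) ^ 9` classes
deviate from `n / k` by more than `n / (k (ln k) ^ 3)`. -/
structure IsBalanced {n k : ℕ} (δ : ℝ) (ζ : Fin n → Fin (k + 1)) : Prop where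
  zeros : (classSize ζ 0 : ℝ) ≤ n * (k : ℝ) ^ (-(2 / 3) : ℝ)
  classes : ∀ i : Fin (k + 1), i ≠ 0 → |(classSize ζ i : ℝ) - n / k| ≤ δ * (n / k)
  deviating : (Set.ncard {i : Fin (k + 1) | i ≠ 0 ∧
    |(classSize ζ i : ℝ) - n / k| > n / (k * Real.log k ^ 3)} : ℝ) ≤ Real.log k ^ 9

/-- The probability that `G(n, m)`, uniform over the graphs on `n` labelled vertices with exactly
`m` edges, has property `P`. (The value is `0` if there is no such graph, i.e. `m > n.choose 2`.) -/
noncomputable def gnmProb (n m : ℕ) (P : SimpleGraph (Fin n) → Prop) : ℝ :=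
  (Set.ncard {G : SimpleGraph (Fin n) | G.edgeSet.ncard = m ∧ P G} : ℝ) /
    (Set.ncard {G : SimpleGraph (Fin n) | G.edgeSet.ncard = m} : ℝ)

/-- With `m = ⌈d n / 2⌉`, the random graph `G(n, m)` has property `P` with high probability. -/
def Whp (d : ℝ) (P : ∀ n : ℕ, SimpleGraph (Fin n) → Prop) : Prop :=
  Tendsto (fun n : ℕ => gnmProb n ⌈d * n / 2⌉₊ (P n)) atTop (𝓝 1)

end ColorCover

namespace ColorCover

/-! The proof is a first-moment count over pairs (`ζ`, `G`), with generating functions in place of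
exact edge counts. Put `L = d / (k - 1)`, roughly the number of neighbors a vertex has in each other
color, and give every edge the weight `y = L k / n`. For fixed `ζ` the edges split into blocks on
which the cover conditions act separately, so the weighted sum over covers is at most a product over
blocks (`sum_pow_card_le_prod`, `sum_cover_le`).

Two kinds of block matter. Between two typical colors each vertex has degree at least two, which
costs about `(1 + L) exp (-L)` in the exponent per vertex and color (`sum_doubleGraphs_le`,
`stabilityRate`). A joker has at most one neighbor in the union of two classes; over the `k ^ 2 / 2`
pairs this gives it a weight of about `q = exp L * (1 + 2 L) * (k ^ 2 / 2) * exp (-2 L)`. Summing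
over all `ζ` yields `(k + q) ^ n`.

Comparison with the number of all graphs with `m` edges leaves the factor `(1 - 1/k) ^ m`. Per
vertex, the logarithm of the resulting bound is about `ln k + k exp (-L) (1 + 2 L) / 2 - k exp (-L)
(1 + L) - (d / 2) (1/k + 1/(2 k ^ 2))`. The terms in `L exp (-L)` cancel and `-k exp (-L) / 2`
remains. For `d = 2 k ln k - ln k - 1 + e` with `L` close to `2 ln k`, this is about `-1/(2k)` and
compensates the `-1` in `d`, so the rate is about `-e/(2k)` (`coverRate_neg_of_near`). For `L ≥ 3 ln
k` the factor `(1 - 1/k) ^ m` suffices without stability (`coverRate_neg_of_large`). -/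

/-! ### Two analytic inequalities -/

/-- A weak Stirling bound; losing a polynomial factor is harmless because the final estimate decays
exponentially in `n`. The factor `h + 1` instead of `h` covers `h = 0`. -/
theorem factorial_mul_exp_le (h : ℕ) :
    (h.factorial : ℝ) * Real.exp h ≤ Real.exp 1 * (h + 1) * (h : ℝ) ^ h := by
  have key : ∀ h : ℕ, ((h + 1).factorial : ℝ) * Real.exp ((h + 1 : ℕ) : ℝ) ≤
      Real.exp 1 * ((h + 1 : ℕ) : ℝ) * ((h + 1 : ℕ) : ℝ) ^ (h + 1) := by
    intro h
    induction h with
    | zero => simp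
    | succ h ih =>
      -- This is `(1 - 1/(h+2)) ^ (h+2) ≤ 1/e`.
      have h1 : Real.exp 1 * ((h : ℝ) + 1) ^ (h + 2) ≤ ((h : ℝ) + 2) ^ (h + 2) := by
        have hb : ((h : ℝ) + 1) / (h + 2) ≤ Real.exp (-(1 / (h + 2))) := by
          have := Real.add_one_le_exp (-(1 / ((h : ℝ) + 2)))
          refine le_trans (le_of_eq ?_) this
          field_simp; ring
        have hp : (((h : ℝ) + 1) / (h + 2)) ^ (h + 2) ≤ Real.exp (-1) := by
          refine (pow_le_pow_left₀ (by positivity) hb _).trans (le_of_eq ?_)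
          rw [← Real.exp_nat_mul]
          congr 1
          push_cast
          field_simp
        rw [div_pow, div_le_iff₀ (by positivity)] at hp
        calc Real.exp 1 * ((h : ℝ) + 1) ^ (h + 2)
            ≤ Real.exp 1 * (Real.exp (-1) * ((h : ℝ) + 2) ^ (h + 2)) := by gcongr
          _ = ((h : ℝ) + 2) ^ (h + 2) := by
            rw [← mul_assoc, ← Real.exp_add]; simp
      rw [Nat.factorial_succ (h + 1)]
      push_cast at ih ⊢
      rw [show (h : ℝ) + 1 + 1 = h + 2 by ring] at *
      have : Real.exp ((h : ℝ) + 2) = Real.exp (h + 1) * Real.exp 1 := by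
        rw [← Real.exp_add]; ring_nf
      rw [this]
      calc ((h : ℝ) + 2) * ((h + 1).factorial : ℝ) * (Real.exp (h + 1) * Real.exp 1)
          = ((h : ℝ) + 2) * Real.exp 1 * (((h + 1).factorial : ℝ) * Real.exp (h + 1)) := by ring
        _ ≤ ((h : ℝ) + 2) * Real.exp 1 * (Real.exp 1 * (h + 1) * ((h : ℝ) + 1) ^ (h + 1)) := by
          gcongr
        _ = Real.exp 1 * (h + 2) * (Real.exp 1 * ((h : ℝ) + 1) ^ (h + 2)) := by ring
        _ ≤ Real.exp 1 * (h + 2) * ((h : ℝ) + 2) ^ (h + 1 + 1) := by gcongr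
  cases h with
  | zero => simp
  | succ h =>
    refine (key h).trans ?_
    gcongr
    linarith

/-- The function `λ ↦ (1 + λ) exp (-λ)` lies above its tangent at `L`. -/
theorem tangent_le {L x : ℝ} (hL : 6 ≤ L) (hx : 0 ≤ x) :
    (1 + L) * Real.exp (-L) - L * Real.exp (-L) * (x - L) ≤ (1 + x) * Real.exp (-x) := by
  suffices h : 1 + L - L * (x - L) ≤ (1 + x) * Real.exp (L - x) by
    have := mul_le_mul_of_nonneg_right h (Real.exp_pos (-L)).le
    rw [mul_assoc, ← Real.exp_add] at this
    ring_nf at this ⊢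
    linarith
  rcases le_total L x with h | h
  -- To the right of `L` the gap has derivative `L - x exp (L - x)`, which is nonnegative since `x ≤
  -- L exp (x - L)`.
  · have hmono : MonotoneOn (fun x : ℝ => (1 + x) * Real.exp (L - x) + L * x) (Set.Ici L) := by
      have hd : ∀ x : ℝ, HasDerivAt (fun x : ℝ => (1 + x) * Real.exp (L - x) + L * x)
          (1 * Real.exp (L - x) + (1 + x) * (Real.exp (L - x) * (-1)) + L * 1) x := by
        intro x
        exact (((hasDerivAt_id x).const_add 1).mul
          (((hasDerivAt_id x).const_sub L).exp)).add ((hasDerivAt_id x).const_mul L)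
      refine monotoneOn_of_deriv_nonneg (convex_Ici L)
        (fun x _ => (hd x).continuousAt.continuousWithinAt)
        (fun x _ => (hd x).differentiableAt.differentiableWithinAt) ?_
      intro x hx
      rw [interior_Ici] at hx
      have hx' : L < x := hx
      rw [(hd x).deriv]
      have h1 : x * Real.exp (L - x) ≤ L := by
        have := Real.add_one_le_exp (x - L)
        have h2 : x ≤ L * Real.exp (x - L) := by nlinarith
        have h3 : Real.exp (x - L) * Real.exp (L - x) = 1 := by
          rw [← Real.exp_add]; simp
        calc x * Real.exp (L - x) ≤ L * Real.exp (x - L) * Real.exp (L - x) := by gcongr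
          _ = L := by rw [mul_assoc, h3, mul_one]
      linarith
    have := hmono (Set.mem_Ici.2 le_rfl) (Set.mem_Ici.2 h) h
    simp at this
    linarith
  · obtain ⟨s, rfl⟩ : ∃ s, x = L - s := ⟨L - x, by ring⟩
    have hs : 0 ≤ s := by linarith
    rw [show L - (L - s) = s by ring]
    have he := Real.quadratic_le_exp_of_nonneg hs
    -- With the quadratic Taylor bound for `exp s` the gap is `s ^ 2 (L - 1 - s) / 2`, which settles
    -- `s ≤ L - 1`. Beyond that `s ≥ 5`, and the cubic Taylor polynomial is large enough.
    rcases le_total s (L - 1) with h1 | h1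
    · have : (1 + (L - s)) * (1 + s + s ^ 2 / 2) ≤ (1 + (L - s)) * Real.exp s := by
        gcongr
      nlinarith [mul_nonneg (sq_nonneg s) (sub_nonneg.2 h1)]
    · have h3 := Real.sum_le_exp_of_nonneg hs 4
      simp [Finset.sum_range_succ, Nat.factorial] at h3
      have h4 : Real.exp s ≤ (1 + (L - s)) * Real.exp s :=
        le_mul_of_one_le_left (Real.exp_pos s).le (by linarith)
      nlinarith [mul_nonneg (sq_nonneg s) (by linarith : (0 : ℝ) ≤ s - 5)]

/-! ### Generating functions of set families -/

/-- A set is determined by its traces on the fibers of `β`, and its size is the sum of theirs. Hence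
the sum on the left is part of the expansion of the product. -/
theorem sum_pow_card_le_prod {E B : Type*} [DecidableEq E] [Fintype B] [DecidableEq B]
    (β : E → B) (F : Finset (Finset E)) (Fb : B → Finset (Finset E))
    (h : ∀ S ∈ F, ∀ b, S.filter (fun e => β e = b) ∈ Fb b) {y : ℝ} (hy : 0 ≤ y) :
    ∑ S ∈ F, y ^ S.card ≤ ∏ b, ∑ T ∈ Fb b, y ^ T.card := by
  classical
  rw [Finset.prod_univ_sum]
  have hinj : Function.Injective
      (fun (S : Finset E) (b : B) => S.filter (fun e => β e = b)) := by
    intro S T hST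
    ext e
    have := congrArg (fun t => e ∈ t) (congrFun hST (β e))
    simpa using this
  have hcard : ∀ S : Finset E, y ^ S.card = ∏ b, y ^ (S.filter (fun e => β e = b)).card := by
    intro S
    rw [Finset.prod_pow_eq_pow_sum]
    congr 1
    exact Finset.card_eq_sum_card_fiberwise (fun _ _ => Finset.mem_univ _)
  calc ∑ S ∈ F, y ^ S.card
      = ∑ p ∈ F.image (fun (S : Finset E) (b : B) => S.filter (fun e => β e = b)),
          ∏ b, y ^ (p b).card := by
        rw [Finset.sum_image hinj.injOn]
        exact Finset.sum_congr rfl fun S _ => hcard S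
    _ ≤ _ := by
        refine Finset.sum_le_sum_of_subset_of_nonneg ?_ fun _ _ _ => by positivity
        intro p hp
        obtain ⟨S, hS, rfl⟩ := Finset.mem_image.1 hp
        exact Fintype.mem_piFinset.2 fun b => h S hS b

theorem sum_powerset_pow_card {E : Type*} (A : Finset E) (y : ℝ) :
    ∑ T ∈ A.powerset, y ^ T.card = (1 + y) ^ A.card := by
  have := Finset.sum_pow_mul_eq_add_pow y 1 A
  simpa [add_comm] using this

theorem sum_powerset_pow_card_le {E : Type*} (A : Finset E) {y : ℝ} (hy : 0 ≤ y) :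
    ∑ T ∈ A.powerset, y ^ T.card ≤ Real.exp (y * A.card) := by
  rw [sum_powerset_pow_card, mul_comm, Real.exp_nat_mul]
  exact pow_le_pow_left₀ (by linarith) (by linarith [Real.add_one_le_exp y]) _

/-- Subsets of `U` that meet `C` at most once. -/
theorem sum_pow_card_meet_le {E : Type*} [DecidableEq E] (U C : Finset E) (hC : C ⊆ U)
    {y : ℝ} (hy : 0 ≤ y) :
    ∑ T ∈ U.powerset.filter (fun T => (T ∩ C).card ≤ 1), y ^ T.card ≤
      Real.exp (y * U.card) * (Real.exp (-(y * C.card)) * (1 + y * C.card)) := by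
  have h := sum_pow_card_le_prod (fun e => decide (e ∈ C))
    (U.powerset.filter (fun T => (T ∩ C).card ≤ 1))
    (fun b => if b then C.powersetCard 0 ∪ C.powersetCard 1 else (U \ C).powerset)
    (by
      intro S hS b
      rw [Finset.mem_filter, Finset.mem_powerset] at hS
      cases b with
      | false =>
        simp only [Bool.false_eq_true, if_false, Finset.mem_powerset]
        intro e he
        simp at he ⊢
        exact ⟨hS.1 he.1, he.2⟩
      | true =>
        simp only [if_true, Finset.mem_union, Finset.mem_powersetCard]
        have e1 : S.filter (fun e => decide (e ∈ C) = true) = S ∩ C := by ext; simp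
        rw [e1]
        have := hS.2
        have hsub : S ∩ C ⊆ C := Finset.inter_subset_right
        rcases Nat.le_one_iff_eq_zero_or_eq_one.1 this with h0 | h1
        · exact Or.inl ⟨hsub, h0⟩
        · exact Or.inr ⟨hsub, h1⟩) hy
  refine h.trans ?_
  rw [Fintype.prod_bool]
  simp only [if_true, Bool.false_eq_true, if_false]
  have h1 : ∑ T ∈ C.powersetCard 0 ∪ C.powersetCard 1, y ^ T.card = 1 + y * C.card := by
    rw [Finset.sum_union (Finset.pairwise_disjoint_powersetCard C (by norm_num))]
    rw [Finset.sum_congr rfl (fun T hT => by rw [(Finset.mem_powersetCard.1 hT).2]),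
      Finset.sum_congr (s₁ := C.powersetCard 1) rfl
        (fun T hT => by rw [(Finset.mem_powersetCard.1 hT).2])]
    simp [mul_comm]
  rw [h1]
  have h2 := sum_powerset_pow_card_le (U \ C) hy
  have h3 : Real.exp (y * (U \ C).card) = Real.exp (y * U.card) * Real.exp (-(y * C.card)) := by
    rw [← Real.exp_add, Finset.card_sdiff_of_subset hC, Nat.cast_sub (Finset.card_le_card hC)]
    ring_nf
  rw [h3] at h2
  calc (1 + y * C.card) * ∑ T ∈ (U \ C).powerset, y ^ T.card
      ≤ (1 + y * C.card) * (Real.exp (y * U.card) * Real.exp (-(y * C.card))) := by gcongr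
    _ = _ := by ring

/-! ### Bipartite graphs of minimum degree two -/

open Classical in
/-- The maps from `H` to `A` all of whose fibers have at least two elements. -/
noncomputable def doubleMaps {V : Type*} [Fintype V] (H : Type) [Fintype H] (A : Finset V) :
    Finset (H → V) :=
  Finset.univ.filter fun g => (∀ e, g e ∈ A) ∧
    ∀ a ∈ A, 2 ≤ (Finset.univ.filter fun e => g e = a).card

/-- The exponential generating function of these maps is `(exp x - 1 - x) ^ |A|`, and its
coefficients are nonnegative, so each term is at most the value at `l`. The induction splits off the
fiber `S` of one point `a`. -/
theorem card_doubleMaps_mul_pow_le {V : Type*} [Fintype V] {l : ℝ} (hl : 0 ≤ l) (A : Finset V) :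
    ∀ (H : Type) [Fintype H], ((doubleMaps H A).card : ℝ) * l ^ Fintype.card H ≤
      (Fintype.card H).factorial * (Real.exp l - 1 - l) ^ A.card := by
  classical
  have hE : 0 ≤ Real.exp l - 1 - l := by linarith [Real.add_one_le_exp l]
  induction A using Finset.induction_on with
  | empty =>
    intro H _
    rcases isEmpty_or_nonempty H with hH | hH
    · have : (doubleMaps H (∅ : Finset V)).card ≤ 1 := by
        refine (Finset.card_le_univ _).trans ?_
        simp
      simp only [Fintype.card_eq_zero, pow_zero, mul_one, Nat.factorial_zero, Nat.cast_one,
        Finset.card_empty]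
      exact_mod_cast this
    · have : doubleMaps H (∅ : Finset V) = ∅ := by
        rw [doubleMaps, Finset.filter_eq_empty_iff]
        rintro g - ⟨h, -⟩
        exact absurd (h (Classical.arbitrary H)) (by simp)
      rw [this]
      simp
  | insert a A ha ih =>
    intro H _
    set N := Fintype.card H with hN
    have hfib : (doubleMaps H (insert a A)).card ≤
        ∑ S ∈ (Finset.univ : Finset (Finset H)).filter (fun S => 2 ≤ S.card),
          (doubleMaps {e // e ∉ S} A).card := by
      rw [Finset.card_eq_sum_card_fiberwise (f := fun g => Finset.univ.filter fun e => g e = a)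
        (t := (Finset.univ : Finset (Finset H)).filter (fun S => 2 ≤ S.card))]
      · refine Finset.sum_le_sum fun S _ => ?_
        refine Finset.card_le_card_of_injOn (fun g e => g e.1) ?_ ?_
        · intro g hg
          simp only [doubleMaps, Finset.coe_filter, Finset.mem_filter, Finset.mem_univ,
            true_and, Set.mem_ofPred_eq] at hg ⊢
          obtain ⟨⟨h1, h2⟩, rfl⟩ := hg
          constructor
          · rintro ⟨e, he⟩
            simp at he
            exact (Finset.mem_insert.1 (h1 e)).resolve_left he
          · intro b hb
            have hba : b ≠ a := fun h => ha (h ▸ hb)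
            refine (h2 b (Finset.mem_insert_of_mem hb)).trans ?_
            refine Finset.card_le_card_of_surjOn (fun e => e.1) ?_
            intro e he
            simp only [Finset.coe_filter, Finset.mem_univ, true_and, Set.mem_ofPred_eq] at he
            refine ⟨⟨e, by simp [he, hba]⟩, by simpa using he, rfl⟩
        · intro g hg g' hg' hgg
          simp only [Finset.coe_filter, Set.mem_ofPred_eq] at hg hg'
          funext e
          by_cases he : e ∈ S
          · have h1 : g e = a := by rw [← hg.2] at he; simpa using he
            have h2 : g' e = a := by rw [← hg'.2] at he; simpa using he
            rw [h1, h2]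
          · exact congrFun hgg ⟨e, he⟩
      · intro g hg
        simp only [doubleMaps, Finset.coe_filter, Finset.mem_univ, true_and,
          Set.mem_ofPred_eq] at hg ⊢
        exact hg.2 a (Finset.mem_insert_self _ _)
    have hterm : ∀ S : Finset H, ((doubleMaps {e // e ∉ S} A).card : ℝ) * l ^ N ≤
        l ^ S.card * ((N - S.card).factorial * (Real.exp l - 1 - l) ^ A.card) := by
      intro S
      have h1 := ih {e // e ∉ S}
      have h2 : Fintype.card {e // e ∉ S} = N - S.card := by
        rw [Fintype.card_subtype_compl, Fintype.card_coe]
      rw [h2] at h1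
      have h3 : S.card ≤ N := Finset.card_le_univ S
      rw [show l ^ N = l ^ S.card * l ^ (N - S.card) by rw [← pow_add]; congr 1; omega]
      calc _ = l ^ S.card * (((doubleMaps {e // e ∉ S} A).card : ℝ) * l ^ (N - S.card)) := by ring
        _ ≤ _ := by gcongr
    -- Grouped by `j = |S|`, `N.choose j * (N - j)! = N! / j!` turns the sum into a partial sum of
    -- the series of `exp l - 1 - l`.
    have hsum : ∑ S ∈ (Finset.univ : Finset (Finset H)).filter (fun S => 2 ≤ S.card),
        l ^ S.card * ((N - S.card).factorial : ℝ) ≤ N.factorial * (Real.exp l - 1 - l) := by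
      rw [Finset.sum_filter]
      have h1 : ∑ S : Finset H, (if 2 ≤ S.card then l ^ S.card * ((N - S.card).factorial : ℝ)
          else 0) = ∑ j ∈ Finset.range (N + 1), (N.choose j : ℝ) *
            (if 2 ≤ j then l ^ j * ((N - j).factorial : ℝ) else 0) := by
        rw [← Finset.powerset_univ]
        have := Finset.sum_powerset_apply_card (fun j => (if 2 ≤ j then l ^ j *
          ((N - j).factorial : ℝ) else 0)) (x := (Finset.univ : Finset H))
        rw [this]
        simp only [Finset.card_univ, nsmul_eq_mul, ← hN]
      rw [h1]
      have h2 := Real.sum_le_exp_of_nonneg hl (N + 2)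
      rw [Finset.sum_range_succ', Finset.sum_range_succ'] at h2
      simp only [zero_add, pow_zero, pow_one, Nat.factorial_zero, Nat.factorial_one, Nat.cast_one,
        div_one] at h2
      have h3 : ∑ j ∈ Finset.range (N + 1), (N.choose j : ℝ) *
            (if 2 ≤ j then l ^ j * ((N - j).factorial : ℝ) else 0) ≤
          ∑ j ∈ Finset.range (N + 2), (N.factorial : ℝ) *
            (if 2 ≤ j then l ^ j / (j.factorial : ℝ) else 0) := by
        refine (Finset.sum_le_sum (g := fun j => (N.factorial : ℝ) *
            (if 2 ≤ j then l ^ j / (j.factorial : ℝ) else 0)) ?_).trans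
          (Finset.sum_le_sum_of_subset_of_nonneg
            (Finset.range_subset_range.2 (by omega)) ?_)
        · intro j hj
          have hjN : j ≤ N := by have := Finset.mem_range.1 hj; omega
          split_ifs with hj2
          · have := Nat.choose_mul_factorial_mul_factorial hjN
            have h' : (N.factorial : ℝ) = N.choose j * j.factorial * (N - j).factorial := by
              exact_mod_cast this.symm
            rw [h']
            have : (j.factorial : ℝ) ≠ 0 := by positivity
            refine le_of_eq ?_
            field_simp
          · simp
        · intro j _ _
          split_ifs <;> positivity
      refine h3.trans ?_
      rw [← Finset.mul_sum, Finset.sum_range_succ', Finset.sum_range_succ']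
      simp only [zero_add]
      norm_num
      refine mul_le_mul_of_nonneg_left ?_ (by positivity)
      norm_num [add_assoc] at h2 ⊢
      linarith
    calc ((doubleMaps H (insert a A)).card : ℝ) * l ^ N
        ≤ (∑ S ∈ (Finset.univ : Finset (Finset H)).filter (fun S => 2 ≤ S.card),
          ((doubleMaps {e // e ∉ S} A).card : ℝ)) * l ^ N := by
          gcongr; exact_mod_cast hfib
      _ ≤ ∑ S ∈ (Finset.univ : Finset (Finset H)).filter (fun S => 2 ≤ S.card),
          l ^ S.card * ((N - S.card).factorial * (Real.exp l - 1 - l) ^ A.card) := by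
          rw [Finset.sum_mul]
          exact Finset.sum_le_sum fun S _ => hterm S
      _ = (∑ S ∈ (Finset.univ : Finset (Finset H)).filter (fun S => 2 ≤ S.card),
          l ^ S.card * ((N - S.card).factorial : ℝ)) * (Real.exp l - 1 - l) ^ A.card := by
          rw [Finset.sum_mul]
          exact Finset.sum_congr rfl fun S _ => by ring
      _ ≤ (N.factorial * (Real.exp l - 1 - l)) * (Real.exp l - 1 - l) ^ A.card := by gcongr
      _ = _ := by
          rw [Finset.card_insert_of_notMem ha]; ring

/-- The generating function is evaluated at the mean fiber size `l = h / |A|`. Replacing `(1 + l)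
exp (-l)` by its tangent at `L` makes the exponent linear in `h`, so that the later sum over `h` is
an exponential series. -/
theorem card_doubleMaps_le {V : Type*} [Fintype V] {L : ℝ} (hL : 6 ≤ L) (A : Finset V)
    (hA : A.Nonempty) (h : ℕ) :
    ((doubleMaps (Fin h) A).card : ℝ) ≤ Real.exp 1 * (h + 1) * (A.card : ℝ) ^ h *
      (Real.exp (h * (L * Real.exp (-L))) *
        Real.exp (-(A.card * ((1 + L) * Real.exp (-L) + L * (L * Real.exp (-L)))))) := by
  classical
  rcases Nat.eq_zero_or_pos h with rfl | hh
  · have : doubleMaps (Fin 0) A = ∅ := by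
      rw [doubleMaps, Finset.filter_eq_empty_iff]
      rintro g - ⟨-, h2⟩
      obtain ⟨a, ha⟩ := hA
      have := h2 a ha
      simp at this
    rw [this]
    simp
    positivity
  have ha : (0 : ℝ) < A.card := by exact_mod_cast hA.card_pos
  have hh' : (0 : ℝ) < h := by exact_mod_cast hh
  set a : ℝ := (A.card : ℝ) with hadef
  have hl : 0 < (h : ℝ) / a := by positivity
  have h1 := card_doubleMaps_mul_pow_le hl.le A (Fin h)
  rw [Fintype.card_fin] at h1
  set l : ℝ := h / a with hldef
  have h2 : (Real.exp l - 1 - l) ^ A.card ≤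
      Real.exp h * Real.exp (-(a * ((1 + l) * Real.exp (-l)))) := by
    -- `exp l - 1 - l = exp l * (1 - (1 + l) exp (-l))`, then `1 - x ≤ exp (-x)`.
    have e1 : Real.exp l - 1 - l ≤ Real.exp (l - (1 + l) * Real.exp (-l)) := by
      have := Real.add_one_le_exp (-((1 + l) * Real.exp (-l)))
      have h3 : Real.exp l * Real.exp (-l) = 1 := by rw [← Real.exp_add]; simp
      rw [sub_eq_add_neg l, Real.exp_add]
      calc Real.exp l - 1 - l = Real.exp l * (-((1 + l) * Real.exp (-l)) + 1) := by
            linear_combination (1 + l) * h3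
        _ ≤ _ := by gcongr
    refine (pow_le_pow_left₀ (by linarith [Real.add_one_le_exp l]) e1 _).trans (le_of_eq ?_)
    rw [← Real.exp_nat_mul, ← Real.exp_add, ← hadef]
    congr 1
    rw [hldef]; field_simp; ring
  have h3 := factorial_mul_exp_le h
  have h4 : Real.exp (-(a * ((1 + l) * Real.exp (-l)))) ≤ Real.exp (h * (L * Real.exp (-L))) *
        Real.exp (-(a * ((1 + L) * Real.exp (-L) + L * (L * Real.exp (-L))))) := by
    rw [← Real.exp_add]
    refine Real.exp_le_exp.2 ?_
    have := mul_le_mul_of_nonneg_left (tangent_le hL hl.le) ha.le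
    have e : a * l = h := by rw [hldef]; field_simp
    have e2 : a * ((1 + L) * Real.exp (-L) - L * Real.exp (-L) * (l - L)) =
      a * ((1 + L) * Real.exp (-L) + L * (L * Real.exp (-L))) - h * (L * Real.exp (-L)) := by
      rw [← e]; ring
    linarith
  have h5 : ((doubleMaps (Fin h) A).card : ℝ) * l ^ h ≤ Real.exp 1 * (h + 1) * (h : ℝ) ^ h *
      Real.exp (-(a * ((1 + l) * Real.exp (-l)))) := by
    calc _ ≤ _ := h1
      _ ≤ (h.factorial : ℝ) * (Real.exp h * Real.exp (-(a * ((1 + l) * Real.exp (-l))))) := by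
        gcongr
      _ = ((h.factorial : ℝ) * Real.exp h) * Real.exp (-(a * ((1 + l) * Real.exp (-l)))) := by ring
      _ ≤ _ := by gcongr
  have h6 : (h : ℝ) ^ h = a ^ h * l ^ h := by
    rw [← mul_pow]; congr 1; rw [hldef]; field_simp
  have h7 : 0 < l ^ h := by positivity
  refine le_of_mul_le_mul_right (h5.trans ?_) h7
  rw [h6]
  calc _ = Real.exp 1 * (h + 1) * a ^ h * Real.exp (-(a * ((1 + l) * Real.exp (-l)))) * l ^ h := by
        ring
    _ ≤ _ := by gcongr

open Classical in
/-- The bipartite graphs between `A` and `B` of minimum degree two, as sets of pairs. -/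
noncomputable def doubleGraphs {V : Type*} (A B : Finset V) : Finset (Finset (V × V)) :=
  (A ×ˢ B).powerset.filter fun T =>
    (∀ a ∈ A, 2 ≤ (T.filter fun p => p.1 = a).card) ∧
    ∀ b ∈ B, 2 ≤ (T.filter fun p => p.2 = b).card

theorem mem_doubleGraphs {V : Type*} [DecidableEq V] {A B : Finset V} {T : Finset (V × V)} :
    T ∈ doubleGraphs A B ↔ T ⊆ A ×ˢ B ∧ (∀ a ∈ A, 2 ≤ (T.filter fun p => p.1 = a).card) ∧
      ∀ b ∈ B, 2 ≤ (T.filter fun p => p.2 = b).card := by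
  unfold doubleGraphs
  simp only [Finset.mem_filter, Finset.mem_powerset]
  convert Iff.rfl

theorem subset_of_mem_doubleGraphs {V : Type*} {A B : Finset V} {T : Finset (V × V)}
    (h : T ∈ doubleGraphs A B) : T ⊆ A ×ˢ B :=
  Finset.mem_powerset.1 (Finset.mem_filter.1 h).1

/-- A graph with `h` edges has `h!` enumerations of its edges. The two coordinates of an enumeration
are maps with all fibers of size at least two, and together they determine it. -/
theorem card_doubleGraphs_le {V : Type*} [Fintype V] (A B : Finset V) (h : ℕ) :
    ((doubleGraphs A B).filter fun T => T.card = h).card * h.factorial ≤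
      (doubleMaps (Fin h) A).card * (doubleMaps (Fin h) B).card := by
  classical
  set F := (doubleGraphs A B).filter fun T => T.card = h with hF
  rw [← Finset.card_product]
  set M : Finset (Fin h → V × V) := Finset.univ.filter fun g =>
    Function.Injective g ∧ Finset.univ.image g ∈ F with hM
  have h1 : F.card * h.factorial ≤ M.card := by
    rw [Finset.card_eq_sum_card_fiberwise (s := M) (t := F) (f := fun g => Finset.univ.image g)
      (by intro g hg; simp [hM] at hg ⊢; exact hg.2)]
    rw [← smul_eq_mul]
    refine Finset.card_nsmul_le_sum _ _ _ ?_
    intro T hT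
    have hTc : T.card = h := (Finset.mem_filter.1 hT).2
    have e : T ≃ Fin h := T.equivFinOfCardEq hTc
    have : h.factorial = (Finset.univ : Finset (Equiv.Perm (Fin h))).card := by
      rw [Finset.card_univ, Fintype.card_perm, Fintype.card_fin]
    rw [this]
    refine Finset.card_le_card_of_injOn (fun σ x => (e.symm (σ x)).1) ?_ ?_
    · intro σ _
      have hi : Finset.univ.image (fun x => (e.symm (σ x)).1) = T := by
        ext p
        simp only [Finset.mem_image, Finset.mem_univ, true_and]
        constructor
        · rintro ⟨x, rfl⟩; exact (e.symm (σ x)).2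
        · intro hp
          exact ⟨σ.symm (e ⟨p, hp⟩), by simp⟩
      simp only [Finset.coe_filter, Set.mem_ofPred_eq, hM, Finset.mem_filter, Finset.mem_univ,
        true_and, hi, hT, and_true]
      intro x y hxy
      simpa using hxy
    · intro σ _ τ _ hst
      ext x
      have := congrFun hst x
      simp only [Subtype.val_inj, EmbeddingLike.apply_eq_iff_eq] at this
      rw [this]
  refine h1.trans ?_
  refine Finset.card_le_card_of_injOn (fun g => (fun x => (g x).1, fun x => (g x).2)) ?_ ?_
  · intro g hg
    simp only [hM, hF, doubleGraphs, Finset.coe_filter, Finset.mem_filter, Finset.mem_univ,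
      true_and, Finset.mem_powerset, Set.mem_ofPred_eq] at hg
    obtain ⟨hinj, ⟨hsub, hA, hB⟩, hc⟩ := hg
    have hfil : ∀ P : V × V → Prop, [DecidablePred P] →
        ((Finset.univ.image g).filter P).card ≤
          (Finset.univ.filter fun x => P (g x)).card := by
      intro P _
      rw [Finset.filter_image]
      exact Finset.card_image_le
    have hmem : ∀ x, g x ∈ A ×ˢ B := fun x =>
      hsub (Finset.mem_image_of_mem _ (Finset.mem_univ _))
    simp only [Finset.coe_product, Set.mem_prod, Finset.mem_coe, doubleMaps, Finset.mem_filter,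
      Finset.mem_univ, true_and]
    exact ⟨⟨fun x => (Finset.mem_product.1 (hmem x)).1,
        fun a ha => (hA a ha).trans (hfil (fun p => p.1 = a))⟩,
      ⟨fun x => (Finset.mem_product.1 (hmem x)).2,
        fun a ha => (hB a ha).trans (hfil (fun p => p.2 = a))⟩⟩
  · intro g _ g' _ hgg
    simp only [Prod.mk.injEq] at hgg
    funext x
    exact Prod.ext (congrFun hgg.1 x) (congrFun hgg.2 x)

/-- Each side contributes `exp (h c)` with `c = L exp (-L)`, so the sum over `h` is a partial
exponential series at `y |A| |B| exp (2 c)`. The polynomial factors in `h` are bounded at `h = |A|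
|B|`. -/
theorem sum_doubleGraphs_le {V : Type*} [Fintype V] {L : ℝ} (hL : 6 ≤ L) (A B : Finset V)
    (hA : A.Nonempty) (hB : B.Nonempty) {y : ℝ} (hy : 0 ≤ y) :
    ∑ T ∈ doubleGraphs A B, y ^ T.card ≤ (Real.exp 1 * (A.card * B.card + 1)) ^ 2 *
      (Real.exp (y * A.card * B.card * Real.exp (2 * (L * Real.exp (-L)))) *
        Real.exp (-((A.card + B.card) *
          ((1 + L) * Real.exp (-L) + L * (L * Real.exp (-L)))))) := by
  classical
  set N := A.card * B.card with hN
  set a : ℝ := (A.card : ℝ)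
  set b : ℝ := (B.card : ℝ)
  set c := L * Real.exp (-L)
  set K := (1 + L) * Real.exp (-L) + L * c
  have hle : ∀ T ∈ doubleGraphs A B, T.card ≤ N := by
    intro T hT
    rw [hN, ← Finset.card_product]
    exact Finset.card_le_card (subset_of_mem_doubleGraphs hT)
  have hNab : (N : ℝ) = a * b := by rw [hN]; push_cast; rfl
  calc ∑ T ∈ doubleGraphs A B, y ^ T.card
      = ∑ h ∈ Finset.range (N + 1), ∑ T ∈ (doubleGraphs A B).filter (fun T => T.card = h),
          y ^ T.card := by
        rw [Finset.sum_fiberwise_of_maps_to]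
        intro T hT
        exact Finset.mem_range.2 (Nat.lt_succ_of_le (hle T hT))
    _ = ∑ h ∈ Finset.range (N + 1),
          (((doubleGraphs A B).filter fun T => T.card = h).card : ℝ) * y ^ h := by
        refine Finset.sum_congr rfl fun h _ => ?_
        rw [Finset.sum_congr rfl (fun T hT => by rw [(Finset.mem_filter.1 hT).2])]
        simp
    _ ≤ ∑ h ∈ Finset.range (N + 1), ((Real.exp 1 * (a * b + 1)) ^ 2 *
          Real.exp (-((a + b) * K))) * ((y * a * b * Real.exp (2 * c)) ^ h / h.factorial) := by
        refine Finset.sum_le_sum fun h hh => ?_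
        have hhN : (h : ℝ) ≤ a * b := by
          rw [← hNab]; exact_mod_cast Nat.lt_succ_iff.1 (Finset.mem_range.1 hh)
        have h1 : (((doubleGraphs A B).filter fun T => T.card = h).card : ℝ) * h.factorial ≤
          (doubleMaps (Fin h) A).card * (doubleMaps (Fin h) B).card := by
          exact_mod_cast card_doubleGraphs_le A B h
        have h2 := card_doubleMaps_le hL A hA h
        have h3 := card_doubleMaps_le hL B hB h
        have hf : (0 : ℝ) < h.factorial := by positivity
        rw [mul_div_assoc', le_div_iff₀ hf]
        calc _ = (((doubleGraphs A B).filter fun T => T.card = h).card : ℝ) * h.factorial * y ^ h :=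
              by ring
          _ ≤ (doubleMaps (Fin h) A).card * (doubleMaps (Fin h) B).card * y ^ h := by gcongr
          _ ≤ (Real.exp 1 * (h + 1) * a ^ h * (Real.exp (h * c) * Real.exp (-(a * K)))) *
              (Real.exp 1 * (h + 1) * b ^ h * (Real.exp (h * c) * Real.exp (-(b * K)))) * y ^ h := by
              gcongr
          _ ≤ (Real.exp 1 * (a * b + 1) * a ^ h * (Real.exp (h * c) * Real.exp (-(a * K)))) *
              (Real.exp 1 * (a * b + 1) * b ^ h * (Real.exp (h * c) * Real.exp (-(b * K)))) *
                y ^ h := by gcongr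
          _ = _ := by
              rw [mul_pow (y * a * b), ← Real.exp_nat_mul (2 * c) h,
                show (h : ℝ) * (2 * c) = h * c + h * c by ring, Real.exp_add,
                show -((a + b) * K) = -(a * K) + -(b * K) by ring, Real.exp_add]
              ring
    _ ≤ _ := by
        rw [← Finset.mul_sum]
        have := Real.sum_le_exp_of_nonneg
          (show 0 ≤ y * a * b * Real.exp (2 * c) by positivity) (N + 1)
        calc _ ≤ ((Real.exp 1 * (a * b + 1)) ^ 2 * Real.exp (-((a + b) * K))) *
              Real.exp (y * a * b * Real.exp (2 * c)) := by gcongr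
          _ = _ := by ring

theorem sum_biUnion_le {ι E : Type*} [DecidableEq E] (s : Finset ι) (t : ι → Finset E)
    {f : E → ℝ} (hf : ∀ e, 0 ≤ f e) : ∑ e ∈ s.biUnion t, f e ≤ ∑ i ∈ s, ∑ e ∈ t i, f e := by
  classical
  induction s using Finset.induction_on with
  | empty => simp
  | insert a s ha ih =>
    rw [Finset.biUnion_insert, Finset.sum_insert ha]
    have := Finset.sum_union_inter (s₁ := t a) (s₂ := s.biUnion t) (f := f)
    have h2 : 0 ≤ ∑ e ∈ t a ∩ s.biUnion t, f e := Finset.sum_nonneg fun e _ => hf e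
    linarith

/-! ### Splitting the edges of a cover into blocks -/

/-- The vertices of color `i`. -/
def colorClass {n k : ℕ} (ζ : Fin n → Fin (k + 1)) (i : Fin (k + 1)) : Finset (Fin n) :=
  Finset.univ.filter fun v => ζ v = i

@[simp] theorem mem_colorClass {n k : ℕ} {ζ : Fin n → Fin (k + 1)} {i : Fin (k + 1)} {v : Fin n} :
    v ∈ colorClass ζ i ↔ ζ v = i := by simp [colorClass]

theorem classSize_eq_card {n k : ℕ} (ζ : Fin n → Fin (k + 1)) (i : Fin (k + 1)) :
    classSize ζ i = (colorClass ζ i).card := by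
  rw [classSize, ← Set.ncard_coe_finset]
  congr 1
  ext v
  simp

open Classical in
/-- The edges of `G`, each oriented towards its end of larger color, ties being broken by the
order of the vertices. -/
noncomputable def orientedEdges {n k : ℕ} (ζ : Fin n → Fin (k + 1)) (G : SimpleGraph (Fin n)) :
    Finset (Fin n × Fin n) :=
  Finset.univ.filter fun p =>
    G.Adj p.1 p.2 ∧ (ζ p.1 < ζ p.2 ∨ (ζ p.1 = ζ p.2 ∧ p.1 < p.2))

theorem mem_orientedEdges {n k : ℕ} {ζ : Fin n → Fin (k + 1)} {G : SimpleGraph (Fin n)}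
    {u v : Fin n} : (u, v) ∈ orientedEdges ζ G ↔
      G.Adj u v ∧ (ζ u < ζ v ∨ (ζ u = ζ v ∧ u < v)) := by
  simp [orientedEdges]

theorem adj_iff_mem_orientedEdges {n k : ℕ} (ζ : Fin n → Fin (k + 1)) (G : SimpleGraph (Fin n))
    (u v : Fin n) : G.Adj u v ↔ (u, v) ∈ orientedEdges ζ G ∨ (v, u) ∈ orientedEdges ζ G := by
  rw [mem_orientedEdges, mem_orientedEdges, G.adj_comm v u, ← and_or_left]
  refine ⟨fun h => ⟨h, ?_⟩, fun h => h.1⟩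
  have hne := G.ne_of_adj h
  rcases lt_trichotomy (ζ u) (ζ v) with h1 | h1 | h1
  · exact Or.inl (Or.inl h1)
  · rcases lt_or_gt_of_ne hne with h2 | h2
    · exact Or.inl (Or.inr ⟨h1, h2⟩)
    · exact Or.inr (Or.inr ⟨h1.symm, h2⟩)
  · exact Or.inr (Or.inl h1)

theorem orientedEdges_injective {n k : ℕ} (ζ : Fin n → Fin (k + 1)) :
    Function.Injective (orientedEdges ζ) := by
  intro G G' h
  ext u v
  rw [adj_iff_mem_orientedEdges ζ G, adj_iff_mem_orientedEdges ζ G', h]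

theorem card_orientedEdges {n k : ℕ} (ζ : Fin n → Fin (k + 1)) (G : SimpleGraph (Fin n)) :
    (orientedEdges ζ G).card = G.edgeSet.ncard := by
  classical
  rw [← Set.ncard_coe_finset]
  refine Set.ncard_congr (fun p _ => s(p.1, p.2)) ?_ ?_ ?_
  · rintro ⟨u, v⟩ h
    exact (mem_orientedEdges.1 h).1
  · rintro ⟨u, v⟩ ⟨u', v'⟩ h h' he
    rw [Finset.mem_coe, mem_orientedEdges] at h h'
    simp only [Sym2.eq_iff] at he
    rcases he with ⟨rfl, rfl⟩ | ⟨rfl, rfl⟩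
    · rfl
    · exfalso
      rcases h.2 with h1 | h1 <;> rcases h'.2 with h2 | h2
      · exact lt_asymm h1 h2
      · exact h1.ne h2.1.symm
      · exact h2.ne h1.1.symm
      · exact lt_asymm h1.2 h2.2
  · intro e
    induction e using Sym2.ind with
    | _ u v =>
      intro h
      rcases (adj_iff_mem_orientedEdges ζ G u v).1 h with h | h
      · exact ⟨(u, v), h, rfl⟩
      · exact ⟨(v, u), h, Sym2.eq_swap⟩

/-- The block of an oriented edge: edges from a vertex of color `0` to a vertex of nonzero color
are grouped by their source, all others by the colors of their ends. -/
def edgeBlock {n k : ℕ} (ζ : Fin n → Fin (k + 1)) (p : Fin n × Fin n) :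
    (Fin (k + 1) × Fin (k + 1)) ⊕ Fin n :=
  if ζ p.1 = 0 ∧ ζ p.2 ≠ 0 then Sum.inr p.1 else Sum.inl (ζ p.1, ζ p.2)

/-- The neighborhoods, outside color `0`, that a vertex of color `0` may have in a cover. -/
def jokerNeighborhoods {n k : ℕ} (ζ : Fin n → Fin (k + 1)) : Finset (Finset (Fin n)) :=
  (Finset.univ.filter fun v => ζ v ≠ 0).powerset.filter fun N =>
    ∃ i j : Fin (k + 1), i ≠ 0 ∧ i < j ∧ (N ∩ (colorClass ζ i ∪ colorClass ζ j)).card ≤ 1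

open Classical in
/-- The sets of oriented edges that a cover may have in a given block. -/
noncomputable def blockFamily {n k : ℕ} (ζ : Fin n → Fin (k + 1)) (J : Finset (Fin (k + 1))) :
    (Fin (k + 1) × Fin (k + 1)) ⊕ Fin n → Finset (Finset (Fin n × Fin n))
  | Sum.inl (i, j) =>
    if i ≠ 0 ∧ i < j then
      if i ∈ J ∧ j ∈ J then doubleGraphs (colorClass ζ i) (colorClass ζ j)
      else (colorClass ζ i ×ˢ colorClass ζ j).powerset
    else if i = 0 ∧ j = 0 then
      ((colorClass ζ 0 ×ˢ colorClass ζ 0).filter fun p => p.1 < p.2).powerset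
    else {∅}
  | Sum.inr u =>
    if ζ u = 0 then (jokerNeighborhoods ζ).image fun N => N.image fun v => (u, v) else {∅}

/-- All three cover conditions enter here: properness empties the blocks inside a nonzero color,
stability gives minimum degree two between colors of `J`, and the joker condition restricts the
stars at color `0`. -/
theorem filter_edgeBlock_mem_blockFamily {n k : ℕ} (ζ : Fin n → Fin (k + 1))
    (J : Finset (Fin (k + 1))) (hJ : 0 ∉ J) {G : SimpleGraph (Fin n)} (hG : IsCover G ζ)
    (b : (Fin (k + 1) × Fin (k + 1)) ⊕ Fin n) :
    (orientedEdges ζ G).filter (fun e => edgeBlock ζ e = b) ∈ blockFamily ζ J b := by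
  classical
  rcases b with ⟨i, j⟩ | u
  · have hmem : ∀ u v, (u, v) ∈ (orientedEdges ζ G).filter
        (fun e => edgeBlock ζ e = Sum.inl (i, j)) ↔ (u, v) ∈ orientedEdges ζ G ∧
          ¬ (ζ u = 0 ∧ ζ v ≠ 0) ∧ ζ u = i ∧ ζ v = j := by
      intro u v
      rw [Finset.mem_filter, edgeBlock]
      by_cases h : ζ u = 0 ∧ ζ v ≠ 0
      · simp [h]
      · rw [if_neg h]; simp only [h]; simp
    set T := (orientedEdges ζ G).filter (fun e => edgeBlock ζ e = Sum.inl (i, j)) with hT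
    have hsub : T ⊆ colorClass ζ i ×ˢ colorClass ζ j := by
      rintro ⟨u, v⟩ h
      have := ((hmem u v).1 h).2.2
      simpa using this
    simp only [blockFamily]
    split_ifs with h1 h2 h3
    · rw [mem_doubleGraphs]
      refine ⟨hsub, ?_, ?_⟩
      · intro a ha
        rw [mem_colorClass] at ha
        obtain ⟨u₁, u₂, hne, ha1, ha2, hc1, hc2⟩ :=
          (hG.stable a (ha ▸ h1.1)).2 j (by rintro rfl; exact hJ h2.2) (ha ▸ h1.2.ne')
        refine Finset.one_lt_card.2 ⟨(a, u₁), ?_, (a, u₂), ?_, by simpa using hne⟩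
        · rw [Finset.mem_filter, hmem, mem_orientedEdges]
          refine ⟨⟨⟨ha1, Or.inl ?_⟩, fun h => h1.1 (ha ▸ h.1), ha, hc1⟩, rfl⟩
          rw [ha, hc1]; exact h1.2
        · rw [Finset.mem_filter, hmem, mem_orientedEdges]
          refine ⟨⟨⟨ha2, Or.inl ?_⟩, fun h => h1.1 (ha ▸ h.1), ha, hc2⟩, rfl⟩
          rw [ha, hc2]; exact h1.2
      · intro a ha
        rw [mem_colorClass] at ha
        obtain ⟨u₁, u₂, hne, ha1, ha2, hc1, hc2⟩ :=
          (hG.stable a (by rw [ha]; rintro rfl; exact hJ h2.2)).2 i h1.1 (ha ▸ h1.2.ne)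
        refine Finset.one_lt_card.2 ⟨(u₁, a), ?_, (u₂, a), ?_, by simpa using hne⟩
        · rw [Finset.mem_filter, hmem, mem_orientedEdges]
          refine ⟨⟨⟨ha1.symm, Or.inl ?_⟩, fun h => h1.1 (hc1 ▸ h.1), hc1, ha⟩, rfl⟩
          rw [ha, hc1]; exact h1.2
        · rw [Finset.mem_filter, hmem, mem_orientedEdges]
          refine ⟨⟨⟨ha2.symm, Or.inl ?_⟩, fun h => h1.1 (hc2 ▸ h.1), hc2, ha⟩, rfl⟩
          rw [ha, hc2]; exact h1.2
    · exact Finset.mem_powerset.2 hsub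
    · obtain ⟨rfl, rfl⟩ := h3
      rw [Finset.mem_powerset]
      rintro ⟨u, v⟩ h
      rw [Finset.mem_filter]
      refine ⟨hsub h, ?_⟩
      obtain ⟨h4, -, h5, h6⟩ := (hmem u v).1 h
      rcases (mem_orientedEdges.1 h4).2 with h7 | h7
      · rw [h5, h6] at h7; exact absurd h7 (lt_irrefl _)
      · exact h7.2
    · rw [Finset.mem_singleton, Finset.eq_empty_iff_forall_notMem]
      rintro ⟨u, v⟩ h
      obtain ⟨h4, h8, h5, h6⟩ := (hmem u v).1 h
      rw [mem_orientedEdges] at h4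
      rcases h4.2 with h7 | h7
      · have : ζ u ≠ 0 := fun h0 => h8 ⟨h0, by rintro h; rw [h0, h] at h7; exact lt_irrefl _ h7⟩
        exact h1 ⟨h5 ▸ this, h5 ▸ h6 ▸ h7⟩
      · refine hG.proper u v h4.1 ⟨h7.1, fun h0 => h3 ⟨?_, ?_⟩⟩
        · rw [← h5, h7.1, h0]
        · rw [← h6, h0]
  · have hmem : ∀ v w, (v, w) ∈ (orientedEdges ζ G).filter
        (fun e => edgeBlock ζ e = Sum.inr u) ↔ (v, w) ∈ orientedEdges ζ G ∧
          (ζ v = 0 ∧ ζ w ≠ 0) ∧ v = u := by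
      intro v w
      rw [Finset.mem_filter, edgeBlock]
      by_cases h : ζ v = 0 ∧ ζ w ≠ 0
      · rw [if_pos h]; simp [h]
      · rw [if_neg h]; simp [h]
    set T := (orientedEdges ζ G).filter (fun e => edgeBlock ζ e = Sum.inr u) with hT
    simp only [blockFamily]
    split_ifs with h1
    · rw [Finset.mem_image]
      refine ⟨Finset.univ.filter fun v => G.Adj u v ∧ ζ v ≠ 0, ?_, ?_⟩
      · rw [jokerNeighborhoods, Finset.mem_filter, Finset.mem_powerset]
        refine ⟨fun v hv => by simp at hv ⊢; exact hv.2, ?_⟩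
        obtain ⟨i, j, hi, hj, hij, hni, hnj⟩ := hG.joker u h1
        -- The condition is symmetrized in `i` and `j`: none in one class and at most one in the
        -- other becomes at most one in the union.
        have hcard : ((Finset.univ.filter fun v => G.Adj u v ∧ ζ v ≠ 0) ∩
            (colorClass ζ i ∪ colorClass ζ j)).card ≤ 1 := by
          rw [Finset.card_le_one]
          intro a ha b hb
          simp at ha hb
          exact hnj a b ha.1.1 hb.1.1 (ha.2.resolve_left (hni a ha.1.1))
            (hb.2.resolve_left (hni b hb.1.1))
        rcases lt_or_gt_of_ne hij with h | h
        · exact ⟨i, j, hi, h, hcard⟩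
        · exact ⟨j, i, hj, h, by rwa [Finset.union_comm]⟩
      · ext ⟨v, w⟩
        rw [hmem, mem_orientedEdges]
        simp only [Finset.mem_image, Finset.mem_filter, Finset.mem_univ, true_and, Prod.mk.injEq]
        constructor
        · rintro ⟨x, ⟨hx1, hx2⟩, rfl, rfl⟩
          exact ⟨⟨hx1, Or.inl (by rw [h1]; exact Fin.pos_of_ne_zero hx2)⟩, ⟨h1, hx2⟩, rfl⟩
        · rintro ⟨h2, h3, rfl⟩
          exact ⟨w, ⟨h2.1, h3.2⟩, rfl, rfl⟩
    · rw [Finset.mem_singleton, Finset.eq_empty_iff_forall_notMem]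
      rintro ⟨v, w⟩ h
      obtain ⟨-, h2, rfl⟩ := (hmem v w).1 h
      exact h1 h2.1

theorem two_mul_card_filter_lt_le {n : ℕ} (A : Finset (Fin n)) :
    2 * ((A ×ˢ A).filter fun p => p.1 < p.2).card ≤ A.card ^ 2 := by
  have h1 : ((A ×ˢ A).filter fun p => p.1 < p.2).card ≤
      ((A ×ˢ A).filter fun p => ¬ p.1 < p.2).card := by
    refine Finset.card_le_card_of_injOn Prod.swap ?_ Prod.swap_injective.injOn
    rintro ⟨a, b⟩ h
    simp at h ⊢
    exact ⟨⟨h.1.2, h.1.1⟩, h.2.le⟩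
  have h2 := Finset.card_filter_add_card_filter_not (s := A ×ˢ A) (fun p => p.1 < p.2)
  rw [Finset.card_product] at h2
  rw [sq]
  omega

/-- An upper bound for the generating function of the neighborhoods of a vertex of color `0`. -/
noncomputable def jokerWeight {n k : ℕ} (ζ : Fin n → Fin (k + 1)) (y : ℝ) : ℝ :=
  ∑ p ∈ (Finset.univ : Finset (Fin (k + 1) × Fin (k + 1))).filter (fun p => p.1 ≠ 0 ∧ p.1 < p.2),
    Real.exp (-(y * ((colorClass ζ p.1).card + (colorClass ζ p.2).card))) *
      (1 + y * ((colorClass ζ p.1).card + (colorClass ζ p.2).card))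

theorem jokerWeight_nonneg {n k : ℕ} (ζ : Fin n → Fin (k + 1)) {y : ℝ} (hy : 0 ≤ y) :
    0 ≤ jokerWeight ζ y :=
  Finset.sum_nonneg fun _ _ => by positivity

/-- A union bound over unordered pairs. Working with the union of two classes of size about `n/k`
gives `(k ^ 2 / 2) (1 + 2 L)`; ordered pairs would give `k ^ 2 (1 + L)`, and the term `-k exp (-L) /
2` of the final balance would be lost. -/
theorem sum_jokerNeighborhoods_le {n k : ℕ} (ζ : Fin n → Fin (k + 1)) {y : ℝ} (hy : 0 ≤ y) :
    ∑ N ∈ jokerNeighborhoods ζ, y ^ N.card ≤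
      Real.exp (y * (n - (colorClass ζ 0).card)) * jokerWeight ζ y := by
  classical
  set U : Finset (Fin n) := Finset.univ.filter fun v => ζ v ≠ 0 with hU
  have hUc : (U.card : ℝ) = n - (colorClass ζ 0).card := by
    have := Finset.card_filter_add_card_filter_not (s := (Finset.univ : Finset (Fin n)))
      (fun v => ζ v = 0)
    rw [Finset.card_univ, Fintype.card_fin] at this
    have h2 : ((colorClass ζ 0).card : ℝ) + U.card = n := by
      rw [colorClass, hU]; exact_mod_cast this
    linarith
  set P := (Finset.univ : Finset (Fin (k + 1) × Fin (k + 1))).filter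
    (fun p => p.1 ≠ 0 ∧ p.1 < p.2) with hP
  have hsub : jokerNeighborhoods ζ ⊆ P.biUnion fun p =>
      U.powerset.filter fun N => (N ∩ (colorClass ζ p.1 ∪ colorClass ζ p.2)).card ≤ 1 := by
    intro N hN
    rw [jokerNeighborhoods, Finset.mem_filter] at hN
    obtain ⟨h1, i, j, hi, hij, hc⟩ := hN
    rw [Finset.mem_biUnion]
    exact ⟨(i, j), by simp [hP, hi, hij], Finset.mem_filter.2 ⟨h1, hc⟩⟩
  calc ∑ N ∈ jokerNeighborhoods ζ, y ^ N.card
      ≤ ∑ N ∈ P.biUnion fun p =>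
      U.powerset.filter fun N => (N ∩ (colorClass ζ p.1 ∪ colorClass ζ p.2)).card ≤ 1,
        y ^ N.card := Finset.sum_le_sum_of_subset_of_nonneg hsub fun _ _ _ => by positivity
    _ ≤ ∑ p ∈ P, ∑ N ∈ U.powerset.filter fun N =>
        (N ∩ (colorClass ζ p.1 ∪ colorClass ζ p.2)).card ≤ 1, y ^ N.card :=
      sum_biUnion_le _ _ fun _ => by positivity
    _ ≤ _ := by
      rw [jokerWeight, Finset.mul_sum]
      refine Finset.sum_le_sum fun p hp => ?_
      simp only [hP, Finset.mem_filter, Finset.mem_univ, true_and] at hp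
      have hd : Disjoint (colorClass ζ p.1) (colorClass ζ p.2) := by
        rw [Finset.disjoint_left]
        intro v h1 h2
        rw [mem_colorClass] at h1 h2
        exact hp.2.ne (h1.symm.trans h2)
      have h := sum_pow_card_meet_le U (colorClass ζ p.1 ∪ colorClass ζ p.2) (by
        intro v hv
        simp at hv
        simp only [hU, Finset.mem_filter, Finset.mem_univ, true_and]
        rcases hv with hv | hv
        · rw [hv]; exact hp.1
        · rw [hv]; exact (Fin.pos_of_ne_zero hp.1 |>.trans hp.2).ne') hy
      rw [Finset.card_union_of_disjoint hd, hUc] at h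
      push_cast at h
      exact h

/-- The main term in the exponent of the bound for a block of edges between two colors. -/
noncomputable def blockExponent {n k : ℕ} (ζ : Fin n → Fin (k + 1)) (J : Finset (Fin (k + 1)))
    (y κ : ℝ) (i j : Fin (k + 1)) : ℝ :=
  (if i ≠ 0 ∧ i < j then y * ((colorClass ζ i).card * (colorClass ζ j).card) else 0) +
  (if i = 0 ∧ j = 0 then y * ((colorClass ζ 0).card ^ 2 / 2) else 0) -
  (if i ∈ J ∧ j ∈ J ∧ i < j then κ * ((colorClass ζ i).card + (colorClass ζ j).card) else 0)

/-- The oriented edges determine the graph, so the sum is bounded by the product over blocks. The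
prefactor `Q`, later polynomial in `n`, is paid at most once for each of the `(k + 1) ^ 2` ordered
pairs of colors. -/
theorem sum_cover_le {n k : ℕ} (ζ : Fin n → Fin (k + 1)) (J : Finset (Fin (k + 1))) (hJ : 0 ∉ J)
    {y κ Q : ℝ} (hy : 0 ≤ y) (hQ : 1 ≤ Q)
    (hpair : ∀ i ∈ J, ∀ j ∈ J, ∑ T ∈ doubleGraphs (colorClass ζ i) (colorClass ζ j), y ^ T.card ≤
      Q * Real.exp (y * ((colorClass ζ i).card * (colorClass ζ j).card) -
        κ * ((colorClass ζ i).card + (colorClass ζ j).card)))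
    (F : Finset (SimpleGraph (Fin n))) (hF : ∀ G ∈ F, IsCover G ζ) :
    ∑ G ∈ F, y ^ G.edgeSet.ncard ≤ Q ^ ((k + 1) ^ 2) *
      Real.exp (∑ i, ∑ j, blockExponent ζ J y κ i j) *
      (Real.exp (y * (n - (colorClass ζ 0).card)) * jokerWeight ζ y) ^ (colorClass ζ 0).card := by
  classical
  have hW := jokerWeight_nonneg ζ hy
  have h0 : ∑ G ∈ F, y ^ G.edgeSet.ncard = ∑ S ∈ F.image (orientedEdges ζ), y ^ S.card := by
    rw [Finset.sum_image (orientedEdges_injective ζ).injOn]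
    exact Finset.sum_congr rfl fun G _ => by rw [card_orientedEdges]
  rw [h0]
  refine (sum_pow_card_le_prod (edgeBlock ζ) _ (blockFamily ζ J) ?_ hy).trans ?_
  · intro S hS b
    obtain ⟨G, hG, rfl⟩ := Finset.mem_image.1 hS
    exact filter_edgeBlock_mem_blockFamily ζ J hJ (hF G hG) b
  rw [Fintype.prod_sum_type]
  have hnn : ∀ b, 0 ≤ ∑ T ∈ blockFamily ζ J b, y ^ T.card :=
    fun b => Finset.sum_nonneg fun _ _ => by positivity
  refine mul_le_mul ?_ ?_ (Finset.prod_nonneg fun _ _ => hnn _) (by positivity)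
  · have h1 : ∀ p : Fin (k + 1) × Fin (k + 1), ∑ T ∈ blockFamily ζ J (Sum.inl p), y ^ T.card ≤
        Q * Real.exp (blockExponent ζ J y κ p.1 p.2) := by
      rintro ⟨i, j⟩
      have hQe : ∀ x : ℝ, Real.exp x ≤ Q * Real.exp x := fun x =>
        le_mul_of_one_le_left (Real.exp_pos x).le hQ
      simp only [blockFamily, blockExponent]
      by_cases h1 : i ≠ 0 ∧ i < j
      · have hn0 : ¬ (i = 0 ∧ j = 0) := fun h => h1.1 h.1
        rw [if_pos h1, if_pos h1, if_neg hn0]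
        by_cases h2 : i ∈ J ∧ j ∈ J
        · rw [if_pos h2, if_pos ⟨h2.1, h2.2, h1.2⟩, add_zero]
          exact hpair i h2.1 j h2.2
        · rw [if_neg h2, if_neg (fun h => h2 ⟨h.1, h.2.1⟩), add_zero, sub_zero]
          refine (sum_powerset_pow_card_le _ hy).trans ?_
          rw [Finset.card_product, Nat.cast_mul]
          exact hQe _
      · have hnJ : ¬ (i ∈ J ∧ j ∈ J ∧ i < j) := fun h =>
          h1 ⟨fun hi => hJ (hi ▸ h.1), h.2.2⟩
        rw [if_neg h1, if_neg h1, if_neg hnJ]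
        by_cases h3 : i = 0 ∧ j = 0
        · rw [if_pos h3, if_pos h3, zero_add, sub_zero]
          refine (sum_powerset_pow_card_le _ hy).trans (le_trans ?_ (hQe _))
          have h4 : (2 : ℝ) * ((colorClass ζ 0 ×ˢ colorClass ζ 0).filter fun p => p.1 < p.2).card ≤
              (colorClass ζ 0).card ^ 2 := by
            exact_mod_cast two_mul_card_filter_lt_le (colorClass ζ 0)
          gcongr
          linarith
        · rw [if_neg h3, if_neg h3]
          simpa using hQ
    refine (Finset.prod_le_prod (fun _ _ => hnn _) (fun p _ => h1 p)).trans (le_of_eq ?_)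
    rw [Finset.prod_mul_distrib, Finset.prod_const, ← Real.exp_sum, Fintype.sum_prod_type]
    congr 2
    rw [Finset.card_univ, Fintype.card_prod, Fintype.card_fin, sq]
  · have h1 : ∀ u : Fin n, ∑ T ∈ blockFamily ζ J (Sum.inr u), y ^ T.card ≤
        if u ∈ colorClass ζ 0 then
          Real.exp (y * (n - (colorClass ζ 0).card)) * jokerWeight ζ y else 1 := by
      intro u
      simp only [blockFamily, mem_colorClass]
      split_ifs with h
      · rw [Finset.sum_image (by
          intro N _ N' _ hNN
          exact Finset.image_injective (Prod.mk_right_injective u) hNN)]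
        rw [Finset.sum_congr rfl (fun N _ => by
          rw [Finset.card_image_of_injective N (Prod.mk_right_injective u)])]
        exact sum_jokerNeighborhoods_le ζ hy
      · simp
    refine (Finset.prod_le_prod (fun _ _ => hnn _) (fun p _ => h1 p)).trans (le_of_eq ?_)
    rw [Finset.prod_ite_mem, Finset.univ_inter, Finset.prod_const]

/-! ### Estimates for nearly equal color classes -/

theorem sum_sum_eq_two_mul_sum_lt_add {ι : Type*} [Fintype ι] [LinearOrder ι] (f : ι → ι → ℝ)
    (hf : ∀ i j, f i j = f j i) :
    ∑ i, ∑ j, f i j = 2 * (∑ i, ∑ j, if i < j then f i j else 0) + ∑ i, f i i := by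
  have h1 : ∀ i j, f i j = (if i < j then f i j else 0) + (if j < i then f j i else 0) +
      (if i = j then f i i else 0) := by
    intro i j
    rcases lt_trichotomy i j with h | rfl | h
    · simp [h, h.not_gt, h.ne]
    · simp
    · simp [h, h.not_gt, h.ne', hf i j]
  have h2 : ∑ i, ∑ j, (if j < i then f j i else 0) = ∑ i, ∑ j, if i < j then f i j else 0 :=
    Finset.sum_comm
  calc ∑ i, ∑ j, f i j = ∑ i, ∑ j, ((if i < j then f i j else 0) + (if j < i then f j i else 0) +
      (if i = j then f i i else 0)) :=
        Finset.sum_congr rfl fun i _ => Finset.sum_congr rfl fun j _ => h1 i j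
    _ = _ := by
      simp only [Finset.sum_add_distrib]
      rw [h2]
      simp
      ring

theorem one_add_mul_exp_neg_le {s t : ℝ} (hs : 0 ≤ s) (hst : s ≤ t) :
    Real.exp (-t) * (1 + t) ≤ Real.exp (-s) * (1 + s) := by
  have h1 : 1 + t ≤ (1 + s) * Real.exp (t - s) := by
    have := Real.add_one_le_exp (t - s)
    nlinarith
  calc Real.exp (-t) * (1 + t) ≤ Real.exp (-t) * ((1 + s) * Real.exp (t - s)) := by gcongr
    _ = Real.exp (-t) * Real.exp (t - s) * (1 + s) := by ring
    _ = _ := by rw [← Real.exp_add]; ring_nf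

/-- The stability exponent of a pair of color classes of nearly equal sizes. -/
noncomputable def stabilityRate (L η : ℝ) : ℝ :=
  (1 + L) * Real.exp (-L) - η * L * (L * Real.exp (-L)) - 4 * L * (L * Real.exp (-L)) ^ 2

theorem mul_exp_neg_le_quarter {L : ℝ} (hL : 6 ≤ L) : L * Real.exp (-L) ≤ 1 / 4 := by
  have h1 := Real.quadratic_le_exp_of_nonneg (show 0 ≤ L by linarith)
  rw [Real.exp_neg, ← div_eq_mul_inv, div_le_iff₀ (Real.exp_pos L)]
  nlinarith

/-- With `c = L exp (-L)`, the surplus `y |A| |B| (exp (2 c) - 1)` is about `L c (|A| + |B|)` and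
cancels the tangent correction `L * c` in the cost per vertex; only errors of order `η L c` and `L c
^ 2` survive. The choice `κ = 0` forgets stability altogether. -/
theorem sum_doubleGraphs_le_of_card_le {n : ℕ} {L y η κ : ℝ} (hL : 6 ≤ L) (hy : 0 ≤ y)
    (hη : η ≤ 1) (A B : Finset (Fin n)) (hA : A.Nonempty) (hB : B.Nonempty)
    (hyA : y * A.card ≤ L * (1 + η)) (hyB : y * B.card ≤ L * (1 + η))
    (hκ : κ = 0 ∨ κ = stabilityRate L η) :
    ∑ T ∈ doubleGraphs A B, y ^ T.card ≤ (Real.exp 1 * ((n : ℝ) ^ 2 + 1)) ^ 2 *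
      Real.exp (y * (A.card * B.card) - κ * (A.card + B.card)) := by
  have hA' : (A.card : ℝ) ≤ n := by exact_mod_cast (Finset.card_le_univ A).trans (by simp)
  have hB' : (B.card : ℝ) ≤ n := by exact_mod_cast (Finset.card_le_univ B).trans (by simp)
  have hQ : Real.exp 1 * ((A.card : ℝ) * B.card + 1) ≤ Real.exp 1 * ((n : ℝ) ^ 2 + 1) := by
    rw [sq]; gcongr
  rcases hκ with rfl | rfl
  · have h1 : ∑ T ∈ doubleGraphs A B, y ^ T.card ≤ ∑ T ∈ (A ×ˢ B).powerset, y ^ T.card :=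
      Finset.sum_le_sum_of_subset_of_nonneg
        (fun T hT => Finset.mem_powerset.2 (subset_of_mem_doubleGraphs hT))
        fun _ _ _ => by positivity
    refine (h1.trans (sum_powerset_pow_card_le _ hy)).trans ?_
    rw [Finset.card_product, Nat.cast_mul, zero_mul, sub_zero]
    refine le_mul_of_one_le_left (Real.exp_pos _).le (one_le_pow₀ ?_)
    have := Real.add_one_le_exp (1 : ℝ)
    nlinarith [sq_nonneg (n : ℝ)]
  · refine (sum_doubleGraphs_le hL A B hA hB hy).trans ?_
    rw [← Real.exp_add]
    refine mul_le_mul (pow_le_pow_left₀ (by positivity) hQ 2) (Real.exp_le_exp.2 ?_)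
      (Real.exp_pos _).le (by positivity)
    set a : ℝ := (A.card : ℝ)
    set b : ℝ := (B.card : ℝ)
    have ha : 0 ≤ a := Nat.cast_nonneg _
    have hb : 0 ≤ b := Nat.cast_nonneg _
    rw [stabilityRate]
    have hc4 := mul_exp_neg_le_quarter hL
    set c := L * Real.exp (-L) with hc
    have hc0 : 0 ≤ c := by positivity
    have he : Real.exp (2 * c) ≤ 1 + 2 * c + 4 * c ^ 2 := by
      have := (abs_le.1 (Real.abs_exp_sub_one_sub_id_le (x := 2 * c)
        (by rw [abs_of_nonneg (by positivity)]; linarith))).2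
      nlinarith
    -- The average of the two bounds on `y a` and `y b`, multiplied by `b` and `a`.
    have h1 : y * a * b ≤ L * (1 + η) * (a + b) / 2 := by
      have e1 := mul_le_mul_of_nonneg_right hyA hb
      have e2 := mul_le_mul_of_nonneg_right hyB ha
      nlinarith
    have h2 : y * a * b * Real.exp (2 * c) ≤ y * a * b + L * (1 + η) * (a + b) / 2 *
        (2 * c + 4 * c ^ 2) := by
      have e1 : y * a * b * Real.exp (2 * c) ≤ y * a * b * (1 + 2 * c + 4 * c ^ 2) := by gcongr
      have e2 := mul_le_mul_of_nonneg_right h1 (show 0 ≤ 2 * c + 4 * c ^ 2 by positivity)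
      linarith
    have h3 : L * (1 + η) * (a + b) / 2 * (4 * c ^ 2) ≤ L * (1 + 1) * (a + b) / 2 * (4 * c ^ 2) := by
      gcongr
    nlinarith

theorem sum_card_colorClass {n k : ℕ} (ζ : Fin n → Fin (k + 1)) :
    ∑ i, ((colorClass ζ i).card : ℝ) = n := by
  have := Finset.card_eq_sum_card_fiberwise (f := ζ) (s := Finset.univ) (t := Finset.univ)
    (fun _ _ => Finset.mem_univ _)
  rw [Finset.card_univ, Fintype.card_fin] at this
  exact_mod_cast this.symm

theorem card_filter_ne_zero (k : ℕ) :
    ((Finset.univ : Finset (Fin (k + 1))).filter fun i => i ≠ 0).card = k := by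
  rw [Finset.filter_ne', Finset.card_erase_of_mem (Finset.mem_univ _)]
  simp

/-- By Cauchy–Schwarz equal classes maximize the number of bichromatic pairs. With `z` jokers, the
pairs inside color `0` and those leaving it complete the main term to `y (n ^ 2 - (n - z) ^ 2 / k) /
2`; dropping `z ^ 2` leaves an extra `L` per joker. For stability, each class of `J` is counted `|J|
- 1` times. -/
theorem sum_blockExponent_le {n k : ℕ} (ζ : Fin n → Fin (k + 1)) (J : Finset (Fin (k + 1)))
    (hk : 1 ≤ k) (hn : 1 ≤ n) {L η κ w : ℝ} (hL : 0 ≤ L) (hκ : 0 ≤ κ) (hη : η ≤ 1)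
    (hJη : ∀ i ∈ J, (1 - η) * (n / k) ≤ (colorClass ζ i).card) (hw : 1 ≤ w) (hwJ : w ≤ J.card) :
    (∑ i, ∑ j, blockExponent ζ J (L * k / n) κ i j) +
      L * k / n * (n - (colorClass ζ 0).card) * (colorClass ζ 0).card ≤
      L * (k - 1) * n / 2 + L * (colorClass ζ 0).card - n * (κ * ((w - 1) * w * (1 - η) / k)) := by
  classical
  have hk' : (0 : ℝ) < k := by exact_mod_cast hk
  have hn' : (0 : ℝ) < n := by exact_mod_cast hn
  set c : Fin (k + 1) → ℝ := fun i => ((colorClass ζ i).card : ℝ) with hc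
  set y := L * k / n with hy
  have hy0 : 0 ≤ y := by positivity
  set M : Fin (k + 1) → ℝ := fun i => if i ≠ 0 then c i else 0 with hM
  set N : Fin (k + 1) → ℝ := fun i => if i ∈ J then 1 else 0 with hN
  have hsplit : ∑ i, ∑ j, blockExponent ζ J y κ i j =
      y * (∑ i, ∑ j, if i < j then M i * M j else 0) + y * (c 0 ^ 2 / 2) -
      κ * (∑ i, ∑ j, if i < j then N i * N j * (c i + c j) else 0) := by
    have h1 : ∀ i j, blockExponent ζ J y κ i j = y * (if i < j then M i * M j else 0) +
        (if i = 0 then (if j = 0 then y * (c 0 ^ 2 / 2) else 0) else 0) -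
        κ * (if i < j then N i * N j * (c i + c j) else 0) := by
      intro i j
      rw [blockExponent]
      congr 1
      · congr 1
        · by_cases hi : i = 0
          · simp [hM, hi]
          · by_cases hij : i < j
            · have hj : j ≠ 0 := (Fin.pos_of_ne_zero hi |>.trans hij).ne'
              simp [hM, hi, hij, hj, hc]
            · simp [hij]
        · rw [← ite_and]
      · by_cases hi : i ∈ J <;> by_cases hj : j ∈ J <;> by_cases hij : i < j <;>
          simp [hN, hi, hj, hij, hc]
    simp only [h1, Finset.sum_sub_distrib, Finset.sum_add_distrib, ← Finset.mul_sum]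
    simp
  have hMsum : ∑ i, M i = n - c 0 := by
    have := sum_card_colorClass ζ
    have h2 : ∑ i, M i = ∑ i, c i - c 0 := by
      rw [hM, ← Finset.sum_filter, Finset.filter_ne', Finset.sum_erase_eq_sub (Finset.mem_univ _)]
    rw [h2, hc, this]
  have hMsq : (n - c 0) ^ 2 ≤ k * ∑ i, M i * M i := by
    have h2 := sq_sum_le_card_mul_sum_sq (s := (Finset.univ : Finset (Fin (k + 1))).filter
      fun i => i ≠ 0) (f := c)
    rw [card_filter_ne_zero, Finset.sum_filter, Finset.sum_filter] at h2
    rw [← hMsum]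
    refine h2.trans (le_of_eq ?_)
    congr 1
    refine Finset.sum_congr rfl fun i _ => ?_
    simp only [hM]
    split_ifs <;> ring
  have hM2 := sum_sum_eq_two_mul_sum_lt_add (fun i j => M i * M j) (fun i j => mul_comm _ _)
  rw [← Finset.sum_mul_sum, hMsum] at hM2
  have hN2 := sum_sum_eq_two_mul_sum_lt_add (fun i j => N i * N j * (c i + c j))
    (fun i j => by ring)
  have hNN : ∀ i, N i * N i = N i := by intro i; simp [hN]
  set σ := ∑ i, N i * c i with hσ
  have hNcard : ∑ i, N i = J.card := by simp [hN]
  have hN3 : ∑ i, ∑ j, N i * N j * (c i + c j) = 2 * (J.card * σ) := by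
    have h1 : ∀ i j, N i * N j * (c i + c j) = (N i * c i) * N j + N i * (N j * c j) := by
      intro i j; ring
    simp only [h1, Finset.sum_add_distrib]
    rw [← Finset.sum_mul_sum, ← Finset.sum_mul_sum, hNcard]
    ring
  have hN4 : ∑ i, N i * N i * (c i + c i) = 2 * σ := by
    simp only [hNN]
    rw [hσ, Finset.mul_sum]
    exact Finset.sum_congr rfl fun i _ => by ring
  rw [hN3, hN4] at hN2
  have hσle : J.card * ((1 - η) * (n / k)) ≤ σ := by
    have h1 : σ = ∑ i ∈ J, c i := by simp [hσ, hN]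
    rw [h1, ← nsmul_eq_mul]
    exact Finset.card_nsmul_le_sum _ _ _ hJη
  have hη' : 0 ≤ (1 - η) * ((n : ℝ) / k) := mul_nonneg (by linarith) (by positivity)
  have hS : (w - 1) * w * ((1 - η) * (n / k)) ≤
      ∑ i, ∑ j, if i < j then N i * N j * (c i + c j) else 0 := by
    have h1 : (∑ i, ∑ j, if i < j then N i * N j * (c i + c j) else 0) = (J.card - 1) * σ := by
      linarith
    rw [h1]
    calc (w - 1) * w * ((1 - η) * (n / k)) ≤ (J.card - 1) * J.card * ((1 - η) * (n / k)) := by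
          gcongr
          linarith
      _ = (J.card - 1) * (J.card * ((1 - η) * (n / k))) := by ring
      _ ≤ _ := by
        refine mul_le_mul_of_nonneg_left hσle ?_
        linarith
  rw [hsplit]
  have hfin1 : y * (∑ i, ∑ j, if i < j then M i * M j else 0) + y * (c 0 ^ 2 / 2) +
      y * (n - c 0) * c 0 ≤ L * (k - 1) * n / 2 + L * c 0 := by
    have h1 : (∑ i, ∑ j, if i < j then M i * M j else 0) ≤
        ((n - c 0) ^ 2 - (n - c 0) ^ 2 / k) / 2 := by
      have : (n - c 0) ^ 2 / k ≤ ∑ i, M i * M i := by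
        rw [div_le_iff₀ hk']; linarith
      linarith
    calc _ ≤ y * (((n - c 0) ^ 2 - (n - c 0) ^ 2 / k) / 2) + y * (c 0 ^ 2 / 2) +
          y * (n - c 0) * c 0 := by gcongr
      _ = y * ((n ^ 2 - (n - c 0) ^ 2 / k) / 2) := by ring
      _ ≤ y * ((n ^ 2 - (n ^ 2 - 2 * n * c 0) / k) / 2) := by
        gcongr
        nlinarith [sq_nonneg (c 0)]
      _ = _ := by rw [hy]; field_simp; ring
  have hfin2 := mul_le_mul_of_nonneg_left hS hκ
  have e : κ * ((w - 1) * w * ((1 - η) * (n / k))) = n * (κ * ((w - 1) * w * (1 - η) / k)) := by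
    ring
  rw [e] at hfin2
  have hc0 : c 0 = ((colorClass ζ 0).card : ℝ) := rfl
  rw [← hc0]
  linarith

/-- At most `k ^ 2 / 2` pairs lie inside `J` and have the accurate size bound `η`. At most `2 k r`
pairs meet an exceptional color and need only the crude bound `θ`. -/
theorem jokerWeight_le {n k : ℕ} (ζ : Fin n → Fin (k + 1)) (J : Finset (Fin (k + 1)))
    (hJ : 0 ∉ J) (hk : 1 ≤ k) (hn : 1 ≤ n) {L η θ r : ℝ} (hL : 0 ≤ L) (hη0 : 0 ≤ η) (hη : η ≤ 1)
    (hθ0 : 0 ≤ θ) (hθ : θ ≤ 1)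
    (hJη : ∀ i ∈ J, (1 - η) * (n / k) ≤ (colorClass ζ i).card)
    (hJθ : ∀ i, i ≠ 0 → (1 - θ) * (n / k) ≤ (colorClass ζ i).card)
    (hr : (((Finset.univ.filter fun i => i ≠ 0) \ J).card : ℝ) ≤ r) :
    jokerWeight ζ (L * k / n) ≤ (1 + 2 * L) * ((k : ℝ) ^ 2 / 2 * Real.exp (-(2 * L * (1 - η))) +
      2 * k * r * Real.exp (-(2 * L * (1 - θ)))) := by
  classical
  have hk' : (0 : ℝ) < k := by exact_mod_cast hk
  have hn' : (0 : ℝ) < n := by exact_mod_cast hn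
  set U : Finset (Fin (k + 1)) := Finset.univ.filter fun i => i ≠ 0 with hU
  have hUc : U.card = k := card_filter_ne_zero k
  set P := (Finset.univ : Finset (Fin (k + 1) × Fin (k + 1))).filter
    (fun p => p.1 ≠ 0 ∧ p.1 < p.2) with hP
  have hPU : ∀ p ∈ P, p.1 ∈ U ∧ p.2 ∈ U ∧ p.1 < p.2 := by
    intro p hp
    simp only [hP, Finset.mem_filter, Finset.mem_univ, true_and] at hp
    simp only [hU, Finset.mem_filter, Finset.mem_univ, true_and]
    exact ⟨hp.1, (Fin.pos_of_ne_zero hp.1 |>.trans hp.2).ne', hp.2⟩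
  have hterm : ∀ (t : ℝ), 0 ≤ t → t ≤ 1 → ∀ i j : Fin (k + 1),
      (1 - t) * (n / k) ≤ (colorClass ζ i).card → (1 - t) * (n / k) ≤ (colorClass ζ j).card →
      Real.exp (-(L * k / n * ((colorClass ζ i).card + (colorClass ζ j).card))) *
        (1 + L * k / n * ((colorClass ζ i).card + (colorClass ζ j).card)) ≤
        (1 + 2 * L) * Real.exp (-(2 * L * (1 - t))) := by
    intro t ht0 ht1 i j hi hj
    have h1 : 2 * L * (1 - t) ≤ L * k / n * ((colorClass ζ i).card + (colorClass ζ j).card) := by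
      calc 2 * L * (1 - t) = L * k / n * ((1 - t) * (n / k) + (1 - t) * (n / k)) := by
            field_simp; ring
        _ ≤ _ := by gcongr
    have h0 : 0 ≤ 2 * L * (1 - t) := mul_nonneg (by positivity) (by linarith)
    refine (one_add_mul_exp_neg_le h0 h1).trans ?_
    rw [mul_comm]
    have h2 : 0 ≤ 2 * L * t := by positivity
    exact mul_le_mul_of_nonneg_right (by linarith) (Real.exp_pos _).le
  have hcard1 : ((P.filter fun p => p.1 ∈ J ∧ p.2 ∈ J).card : ℝ) ≤ (k : ℝ) ^ 2 / 2 := by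
    have h1 : (P.filter fun p => p.1 ∈ J ∧ p.2 ∈ J) ⊆ (J ×ˢ J).filter fun p => p.1 < p.2 := by
      intro p hp
      rw [Finset.mem_filter] at hp
      rw [Finset.mem_filter, Finset.mem_product]
      exact ⟨hp.2, (hPU p hp.1).2.2⟩
    have h2 := Finset.card_le_card h1
    have h3 := two_mul_card_filter_lt_le J
    have h4 : J.card ≤ k := by
      refine (Finset.card_le_card (t := U) fun i hi => ?_).trans hUc.le
      simp only [hU, Finset.mem_filter, Finset.mem_univ, true_and]
      rintro rfl; exact hJ hi
    have h5 : J.card ^ 2 ≤ k ^ 2 := Nat.pow_le_pow_left h4 2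
    have h6 : 2 * (P.filter fun p => p.1 ∈ J ∧ p.2 ∈ J).card ≤ k ^ 2 := by omega
    have h7 : (2 : ℝ) * (P.filter fun p => p.1 ∈ J ∧ p.2 ∈ J).card ≤ (k : ℝ) ^ 2 := by
      exact_mod_cast h6
    linarith
  have hcard2 : ((P.filter fun p => ¬ (p.1 ∈ J ∧ p.2 ∈ J)).card : ℝ) ≤ 2 * k * r := by
    have h1 : (P.filter fun p => ¬ (p.1 ∈ J ∧ p.2 ∈ J)) ⊆ ((U \ J) ×ˢ U) ∪ (U ×ˢ (U \ J)) := by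
      intro p hp
      rw [Finset.mem_filter] at hp
      have := hPU p hp.1
      simp only [Finset.mem_union, Finset.mem_product, Finset.mem_sdiff]
      tauto
    have h2 := (Finset.card_le_card h1).trans (Finset.card_union_le _ _)
    rw [Finset.card_product, Finset.card_product, hUc] at h2
    have h3 : ((P.filter fun p => ¬ (p.1 ∈ J ∧ p.2 ∈ J)).card : ℝ) ≤
        (U \ J).card * k + k * (U \ J).card := by exact_mod_cast h2
    nlinarith
  rw [jokerWeight, ← Finset.sum_filter_add_sum_filter_not P (fun p => p.1 ∈ J ∧ p.2 ∈ J), mul_add]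
  refine add_le_add ?_ ?_
  · refine (Finset.sum_le_card_nsmul _ _ ((1 + 2 * L) * Real.exp (-(2 * L * (1 - η)))) ?_).trans ?_
    · intro p hp
      rw [Finset.mem_filter] at hp
      exact hterm η hη0 hη _ _ (hJη _ hp.2.1) (hJη _ hp.2.2)
    · rw [nsmul_eq_mul]
      calc _ ≤ (k : ℝ) ^ 2 / 2 * ((1 + 2 * L) * Real.exp (-(2 * L * (1 - η)))) := by gcongr
        _ = _ := by ring
  · refine (Finset.sum_le_card_nsmul _ _ ((1 + 2 * L) * Real.exp (-(2 * L * (1 - θ)))) ?_).trans ?_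
    · intro p hp
      rw [Finset.mem_filter] at hp
      have := hPU p hp.1
      simp only [hU, Finset.mem_filter, Finset.mem_univ, true_and] at this
      exact hterm θ hθ0 hθ _ _ (hJθ _ this.1) (hJθ _ this.2.1)
    · rw [nsmul_eq_mul]
      calc _ ≤ 2 * k * r * ((1 + 2 * L) * Real.exp (-(2 * L * (1 - θ)))) := by gcongr
        _ = _ := by ring

/-- The weight of a vertex of color `0` relative to a vertex of given nonzero color. -/
noncomputable def jokerRate (k : ℕ) (L η θ r : ℝ) : ℝ :=
  Real.exp L * ((1 + 2 * L) * ((k : ℝ) ^ 2 / 2 * Real.exp (-(2 * L * (1 - η))) +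
      2 * k * r * Real.exp (-(2 * L * (1 - θ)))))

theorem sum_balanced_cover_le {n k : ℕ} (ζ : Fin n → Fin (k + 1)) (J : Finset (Fin (k + 1)))
    (hJ : 0 ∉ J) (hk : 1 ≤ k) (hn : 1 ≤ n) {L η θ r κ : ℝ} (hL : 6 ≤ L) (hη0 : 0 ≤ η) (hη : η < 1)
    (hθ0 : 0 ≤ θ) (hθ : θ ≤ 1)
    (hJη : ∀ i ∈ J, |((colorClass ζ i).card : ℝ) - n / k| ≤ η * (n / k))
    (hJθ : ∀ i, i ≠ 0 → (1 - θ) * (n / k) ≤ (colorClass ζ i).card)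
    (hr : (((Finset.univ.filter fun i => i ≠ 0) \ J).card : ℝ) ≤ r) (hrk : 1 ≤ k - r)
    (hκ0 : 0 ≤ κ) (hκ : κ = 0 ∨ κ = stabilityRate L η)
    (F : Finset (SimpleGraph (Fin n))) (hF : ∀ G ∈ F, IsCover G ζ) :
    ∑ G ∈ F, (L * k / n) ^ G.edgeSet.ncard ≤
      ((Real.exp 1 * ((n : ℝ) ^ 2 + 1)) ^ 2) ^ ((k + 1) ^ 2) *
      Real.exp (L * (k - 1) * n / 2 - n * (κ * ((k - r - 1) * (k - r) * (1 - η) / k))) *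
      jokerRate k L η θ r ^ (colorClass ζ 0).card := by
  classical
  have hk' : (0 : ℝ) < k := by exact_mod_cast hk
  have hn' : (0 : ℝ) < n := by exact_mod_cast hn
  have hL0 : 0 ≤ L := by linarith
  have hy : 0 ≤ L * k / n := by positivity
  have hlow : ∀ i ∈ J, (1 - η) * (n / k) ≤ (colorClass ζ i).card := fun i hi => by
    have := (abs_le.1 (hJη i hi)).1
    linarith
  have hup : ∀ i ∈ J, L * k / n * (colorClass ζ i).card ≤ L * (1 + η) := fun i hi => by
    have := (abs_le.1 (hJη i hi)).2
    calc L * k / n * (colorClass ζ i).card ≤ L * k / n * ((1 + η) * (n / k)) := by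
          gcongr; linarith
      _ = _ := by field_simp
  have hne : ∀ i ∈ J, (colorClass ζ i).Nonempty := fun i hi => by
    rw [← Finset.card_pos]
    have : (0 : ℝ) < (colorClass ζ i).card :=
      (mul_pos (by linarith) (by positivity)).trans_le (hlow i hi)
    exact_mod_cast this
  have hJcard : (k : ℝ) - r ≤ J.card := by
    have h1 := Finset.le_card_sdiff J (Finset.univ.filter fun i : Fin (k + 1) => i ≠ 0)
    rw [card_filter_ne_zero] at h1
    have h2 : (k : ℝ) ≤ ((Finset.univ.filter fun i : Fin (k + 1) => i ≠ 0) \ J).card + J.card := by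
      exact_mod_cast Nat.sub_le_iff_le_add.1 h1
    linarith
  have hQ : 1 ≤ (Real.exp 1 * ((n : ℝ) ^ 2 + 1)) ^ 2 := by
    refine one_le_pow₀ ?_
    have := Real.add_one_le_exp (1 : ℝ)
    nlinarith [sq_nonneg (n : ℝ)]
  have h1 := sum_cover_le ζ J hJ hy hQ (fun i hi j hj =>
    sum_doubleGraphs_le_of_card_le hL hy hη.le _ _ (hne i hi) (hne j hj) (hup i hi) (hup j hj) hκ)
    F hF
  refine h1.trans ?_
  rw [mul_assoc, mul_assoc]
  refine mul_le_mul_of_nonneg_left ?_ (by positivity)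
  have h2 := sum_blockExponent_le ζ J hk hn hL0 hκ0 hη.le hlow hrk hJcard
  have h3 := jokerWeight_le ζ J hJ hk hn hL0 hη0 hη.le hθ0 hθ hlow hJθ hr
  have h4 := jokerWeight_nonneg ζ hy
  set z := (colorClass ζ 0).card
  -- The extra `L` per joker becomes the factor `exp L` of `jokerRate`.
  have e1 : Real.exp (∑ i, ∑ j, blockExponent ζ J (L * k / n) κ i j) *
      Real.exp (L * k / n * (n - z)) ^ z ≤
      Real.exp (L * (k - 1) * n / 2 - n * (κ * ((k - r - 1) * (k - r) * (1 - η) / k))) *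
      Real.exp L ^ z := by
    rw [← Real.exp_nat_mul, ← Real.exp_nat_mul, ← Real.exp_add, ← Real.exp_add]
    refine Real.exp_le_exp.2 ?_
    linarith
  rw [jokerRate, mul_pow, mul_pow, ← mul_assoc, ← mul_assoc]
  exact mul_le_mul e1 (pow_le_pow_left₀ h4 h3 _) (by positivity) (by positivity)

/-! ### The first moment -/

/-- The vertices choose independently among `k` colors of weight `1` and the joker of weight `q`. -/
theorem sum_pow_card_colorClass_zero (n k : ℕ) (q : ℝ) :
    ∑ ζ : Fin n → Fin (k + 1), q ^ (colorClass ζ 0).card = (k + q) ^ n := by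
  classical
  have h1 : ∀ ζ : Fin n → Fin (k + 1), q ^ (colorClass ζ 0).card =
      ∏ v, if ζ v = 0 then q else 1 := by
    intro ζ
    rw [Finset.prod_ite, Finset.prod_const, Finset.prod_const_one, mul_one]
    rfl
  simp only [h1]
  have h2 := Finset.prod_univ_sum (fun _ : Fin n => (Finset.univ : Finset (Fin (k + 1))))
    (fun _ i => if i = 0 then q else 1)
  rw [Fintype.piFinset_univ] at h2
  rw [← h2, Finset.prod_const, Finset.card_univ, Fintype.card_fin]
  congr 1
  rw [Fin.sum_univ_succ]
  simp [add_comm]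

theorem choose_le_ncard_edgeSet (n m : ℕ) :
    (n.choose 2).choose m ≤ {G : SimpleGraph (Fin n) | G.edgeSet.ncard = m}.ncard := by
  classical
  have h1 : (n.choose 2).choose m =
      ((⊤ : SimpleGraph (Fin n)).edgeFinset.powersetCard m).card := by
    rw [Finset.card_powersetCard, SimpleGraph.card_edgeFinset_top_eq_card_choose_two,
      Fintype.card_fin]
  have hedge : ∀ S ∈ (⊤ : SimpleGraph (Fin n)).edgeFinset.powersetCard m,
      (SimpleGraph.fromEdgeSet (S : Set (Sym2 (Fin n)))).edgeSet = S := by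
    intro S hS
    rw [SimpleGraph.edgeSet_fromEdgeSet, sdiff_eq_left, Set.disjoint_left]
    intro e he hd
    have := (Finset.mem_powersetCard.1 hS).1 he
    rw [SimpleGraph.mem_edgeFinset] at this
    exact SimpleGraph.not_isDiag_of_mem_edgeSet _ this hd
  rw [h1, ← Set.ncard_coe_finset]
  refine Set.ncard_le_ncard_of_injOn (fun S => SimpleGraph.fromEdgeSet (S : Set (Sym2 (Fin n))))
    ?_ ?_ (Set.toFinite _)
  · intro S hS
    show (SimpleGraph.fromEdgeSet (S : Set (Sym2 (Fin n)))).edgeSet.ncard = m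
    rw [hedge S hS, Set.ncard_coe_finset]
    exact (Finset.mem_powersetCard.1 hS).2
  · intro S hS T hT h
    have := congrArg SimpleGraph.edgeSet h
    simp only [hedge S hS, hedge T hT] at this
    exact_mod_cast this

/-- The quadratic term cannot be dropped: with `x = 1/k` it contributes `d / (4 k ^ 2)`, about `ln k
/ (2k)`, to the rate, and terms of order `1/k` decide the sign. -/
theorem one_sub_le_exp {x : ℝ} (hx : 0 ≤ x) (hx1 : x < 1) :
    1 - x ≤ Real.exp (-(x + x ^ 2 / 2)) := by
  have h := Real.hasSum_pow_div_log_of_abs_lt_one (x := x) (by rw [abs_of_nonneg hx]; exact hx1)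
  have h1 := sum_le_hasSum (Finset.range 2) (fun i _ => by positivity) h
  rw [← Real.log_le_iff_le_exp (by linarith)]
  norm_num [Finset.sum_range_succ] at h1
  linarith

/-- A lower bound for the number of graphs with `m = ⌈d n / 2⌉` edges. -/
theorem exists_pow_le_choose {d : ℝ} (hd : 0 < d) : ∃ K : ℝ, 0 < K ∧ ∀ᶠ n : ℕ in atTop,
    (n / d : ℝ) ^ ⌈d * n / 2⌉₊ * Real.exp (d * n / 2) ≤
      K * n * ((n.choose 2).choose ⌈d * n / 2⌉₊ : ℝ) := by
  -- Each of the `m` factors of the binomial coefficient costs at most `exp (C / n)`: `2 / d` comes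
  -- from the ceiling in `m`, and `2 (1 + d)` from replacing `N + 1 - m` by `n ^ 2 / 2`. Over `m =
  -- O(n)` factors the loss is bounded.
  set C := 2 / d + 2 * (1 + d) with hC
  refine ⟨Real.exp (C * (d / 2 + 1)) * (Real.exp 1 * (d / 2 + 2)), by positivity, ?_⟩
  obtain ⟨n₀, hn₀⟩ := exists_nat_ge (2 * (2 + d))
  filter_upwards [eventually_ge_atTop (n₀ + 2)] with n hn
  have hn0 : (2 * (2 + d) : ℝ) ≤ n := hn₀.trans (by exact_mod_cast (by omega : n₀ ≤ n))
  have hn1 : (1 : ℝ) ≤ n := by exact_mod_cast (by omega : 1 ≤ n)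
  have hnpos : (0 : ℝ) < n := by linarith
  set m := ⌈d * n / 2⌉₊ with hm
  have hm1 : d * n / 2 ≤ m := Nat.le_ceil _
  have hm2 : (m : ℝ) < d * n / 2 + 1 := Nat.ceil_lt_add_one (by positivity)
  set N := n.choose 2 with hN
  have hNr : (N : ℝ) = n * (n - 1) / 2 := Nat.cast_choose_two ℝ n
  have hmN : m ≤ N := by
    have : (m : ℝ) ≤ N := by rw [hNr]; nlinarith
    exact_mod_cast this
  set D : ℝ := ((N + 1 - m : ℕ) : ℝ) with hD
  have hDr : D = N + 1 - m := by rw [hD, Nat.cast_sub (by omega)]; push_cast; ring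
  have hDlow : (n : ℝ) ^ 2 / 2 * (1 - (1 + d) / n) ≤ D := by
    rw [hDr, hNr]
    have : (n : ℝ) ^ 2 / 2 * (1 - (1 + d) / n) = n ^ 2 / 2 - (1 + d) * n / 2 := by field_simp
    rw [this]
    nlinarith
  have hx : (1 + d) / n ≤ 1 / 2 := by rw [div_le_iff₀ hnpos]; linarith
  have hDpos : 0 < D := lt_of_lt_of_le (mul_pos (by positivity) (by linarith)) hDlow
  have hratio : n / d * m ≤ Real.exp (C / n) * D := by
    have h1 : n / d * m ≤ n ^ 2 / 2 * (1 + 2 / (d * n)) := by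
      calc n / d * m ≤ n / d * (d * n / 2 + 1) := by gcongr
        _ = _ := by field_simp
    have h2 : 1 + 2 / (d * n) ≤ Real.exp (2 / (d * n)) := by
      linarith [Real.add_one_le_exp (2 / (d * n))]
    have h3 : 1 ≤ Real.exp (2 * ((1 + d) / n)) * (1 - (1 + d) / n) := by
      have h4 := Real.add_one_le_exp (2 * ((1 + d) / n))
      have h5 : 0 ≤ (1 + d) / n := by positivity
      have h6 : (2 * ((1 + d) / n) + 1) * (1 - (1 + d) / n) ≤
          Real.exp (2 * ((1 + d) / n)) * (1 - (1 + d) / n) :=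
        mul_le_mul_of_nonneg_right h4 (by linarith)
      nlinarith
    calc n / d * m ≤ n ^ 2 / 2 * (1 + 2 / (d * n)) := h1
      _ ≤ n ^ 2 / 2 * Real.exp (2 / (d * n)) := by gcongr
      _ ≤ n ^ 2 / 2 * Real.exp (2 / (d * n)) *
          (Real.exp (2 * ((1 + d) / n)) * (1 - (1 + d) / n)) :=
        le_mul_of_one_le_right (by positivity) h3
      _ = Real.exp (2 / (d * n)) * Real.exp (2 * ((1 + d) / n)) *
          (n ^ 2 / 2 * (1 - (1 + d) / n)) := by ring
      _ = Real.exp (C / n) * (n ^ 2 / 2 * (1 - (1 + d) / n)) := by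
        rw [← Real.exp_add]; congr 2; rw [hC]; field_simp
      _ ≤ _ := by gcongr
  have hchoose : D ^ m ≤ m.factorial * (N.choose m : ℝ) := by
    have h1 := Nat.pow_sub_le_descFactorial N m
    rw [Nat.descFactorial_eq_factorial_mul_choose] at h1
    rw [hD]; exact_mod_cast h1
  have hfact := factorial_mul_exp_le m
  have hmn : (m : ℝ) ≤ (d / 2 + 1) * n := by nlinarith
  have hexpm : Real.exp (C / n) ^ m ≤ Real.exp (C * (d / 2 + 1)) := by
    rw [← Real.exp_nat_mul]
    refine Real.exp_le_exp.2 ?_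
    have hC0 : 0 ≤ C := by positivity
    calc (m : ℝ) * (C / n) ≤ (d / 2 + 1) * n * (C / n) := by gcongr
      _ = _ := by field_simp
  have hmpos : (0 : ℝ) < m := lt_of_lt_of_le (by positivity) hm1
  have hmm : (0 : ℝ) < (m : ℝ) ^ m := by positivity
  refine le_of_mul_le_mul_right ?_ hmm
  calc (n / d : ℝ) ^ m * Real.exp (d * n / 2) * (m : ℝ) ^ m
      ≤ (n / d : ℝ) ^ m * Real.exp m * (m : ℝ) ^ m := by gcongr
    _ = (n / d * m) ^ m * Real.exp m := by rw [mul_pow]; ring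
    _ ≤ (Real.exp (C / n) * D) ^ m * Real.exp m := by gcongr
    _ = Real.exp (C / n) ^ m * D ^ m * Real.exp m := by rw [mul_pow]
    _ ≤ Real.exp (C * (d / 2 + 1)) * (m.factorial * (N.choose m : ℝ)) * Real.exp m := by gcongr
    _ = Real.exp (C * (d / 2 + 1)) * (N.choose m : ℝ) * (m.factorial * Real.exp m) := by ring
    _ ≤ Real.exp (C * (d / 2 + 1)) * (N.choose m : ℝ) *
        (Real.exp 1 * (m + 1) * (m : ℝ) ^ m) := by gcongr
    _ ≤ Real.exp (C * (d / 2 + 1)) * (N.choose m : ℝ) *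
        (Real.exp 1 * ((d / 2 + 2) * n) * (m : ℝ) ^ m) := by
      gcongr
      linarith
    _ = _ := by ring

/-- All graphs counted have the same weight `(L k / n) ^ m`, so their number is controlled by the
generating function. A union bound over balanced `ζ` is then relaxed to the sum over all `ζ`. -/
theorem ncard_cover_mul_pow_le {n k m : ℕ} (hk : 1 ≤ k) (hn : 1 ≤ n) {L δ θ κ : ℝ} (hL : 6 ≤ L)
    (hlog : 1 < Real.log k) (hδ : δ ≤ θ) (hθ0 : 0 ≤ θ) (hθ : θ ≤ 1)
    (hrk : 1 ≤ k - Real.log k ^ 9) (hκ0 : 0 ≤ κ)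
    (hκ : κ = 0 ∨ κ = stabilityRate L (1 / Real.log k ^ 3)) :
    ({G : SimpleGraph (Fin n) | G.edgeSet.ncard = m ∧
      ∃ ζ : Fin n → Fin (k + 1), IsCover G ζ ∧ IsBalanced δ ζ}.ncard : ℝ) * (L * k / n) ^ m ≤
      ((Real.exp 1 * ((n : ℝ) ^ 2 + 1)) ^ 2) ^ ((k + 1) ^ 2) *
      Real.exp (L * (k - 1) * n / 2 - n * (κ * ((k - Real.log k ^ 9 - 1) * (k - Real.log k ^ 9) *
        (1 - 1 / Real.log k ^ 3) / k))) *
      (k + jokerRate k L (1 / Real.log k ^ 3) θ (Real.log k ^ 9)) ^ n := by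
  classical
  have hk' : (0 : ℝ) < k := by exact_mod_cast hk
  have hn' : (0 : ℝ) < n := by exact_mod_cast hn
  set η := 1 / Real.log k ^ 3 with hη
  set r := Real.log k ^ 9 with hr
  have hη0 : 0 ≤ η := by positivity
  have hη1 : η < 1 := by
    rw [hη, div_lt_one (by positivity)]
    exact one_lt_pow₀ hlog (by norm_num)
  set y := L * k / n with hy
  have hy0 : 0 ≤ y := by positivity
  set q := jokerRate k L η θ r with hq
  have hq0 : 0 ≤ q := by
    rw [hq, jokerRate]
    have : 0 ≤ r := by positivity
    positivity
  set A := ((Real.exp 1 * ((n : ℝ) ^ 2 + 1)) ^ 2) ^ ((k + 1) ^ 2) *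
      Real.exp (L * (k - 1) * n / 2 - n * (κ * ((k - r - 1) * (k - r) * (1 - η) / k))) with hA
  have hA0 : 0 ≤ A := by positivity
  set B : Finset (SimpleGraph (Fin n)) := (Set.toFinite {G : SimpleGraph (Fin n) |
    G.edgeSet.ncard = m ∧
      ∃ ζ : Fin n → Fin (k + 1), IsCover G ζ ∧ IsBalanced δ ζ}).toFinset with hB
  set F : (Fin n → Fin (k + 1)) → Finset (SimpleGraph (Fin n)) := fun ζ =>
    (Set.toFinite {G : SimpleGraph (Fin n) | G.edgeSet.ncard = m ∧ IsCover G ζ}).toFinset with hF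
  have hsub : B ⊆ (Finset.univ.filter fun ζ => IsBalanced δ ζ).biUnion F := by
    intro G hG
    rw [hB, Set.Finite.mem_toFinset] at hG
    obtain ⟨h1, ζ, h2, h3⟩ := hG
    rw [Finset.mem_biUnion]
    refine ⟨ζ, by simpa using h3, ?_⟩
    rw [hF, Set.Finite.mem_toFinset]
    exact ⟨h1, h2⟩
  have hζ : ∀ ζ ∈ (Finset.univ.filter fun ζ : Fin n → Fin (k + 1) => IsBalanced δ ζ),
      ∑ G ∈ F ζ, y ^ G.edgeSet.ncard ≤ A * q ^ (colorClass ζ 0).card := by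
    intro ζ hb
    have hb : IsBalanced δ ζ := by simpa using hb
    -- The typical colors; balance leaves at most `ln ^ 9 k` nonzero colors outside.
    set J : Finset (Fin (k + 1)) := Finset.univ.filter fun i =>
      i ≠ 0 ∧ |((colorClass ζ i).card : ℝ) - n / k| ≤ η * (n / k) with hJ
    refine sum_balanced_cover_le ζ J (by simp [hJ]) hk hn hL hη0 hη1 hθ0 hθ ?_ ?_ ?_ hrk hκ0 hκ
      (F ζ) ?_
    · intro i hi
      simp only [hJ, Finset.mem_filter, Finset.mem_univ, true_and] at hi
      exact hi.2
    · intro i hi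
      have h1 := (abs_le.1 (hb.classes i hi)).1
      rw [classSize_eq_card] at h1
      have h2 : δ * ((n : ℝ) / k) ≤ θ * (n / k) := by gcongr
      linarith
    · refine le_trans (le_of_eq ?_) hb.deviating
      rw [← Set.ncard_coe_finset]
      congr 2
      ext i
      have e : η * ((n : ℝ) / k) = n / (k * Real.log k ^ 3) := by
        rw [hη, div_mul_div_comm, one_mul, mul_comm (k : ℝ)]
      rw [e] at hJ
      simp only [hJ, Finset.coe_sdiff, Finset.coe_filter, Finset.mem_univ, true_and,
        Set.mem_sdiff, Set.mem_ofPred_eq, classSize_eq_card, gt_iff_lt, not_and, not_le]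
      tauto
    · intro G hG
      rw [hF, Set.Finite.mem_toFinset] at hG
      exact hG.2
  have hBc : ({G : SimpleGraph (Fin n) | G.edgeSet.ncard = m ∧
      ∃ ζ : Fin n → Fin (k + 1), IsCover G ζ ∧ IsBalanced δ ζ}.ncard : ℝ) * y ^ m =
      ∑ G ∈ B, y ^ G.edgeSet.ncard := by
    have h1 : ∀ G ∈ B, y ^ G.edgeSet.ncard = y ^ m := fun G hG => by
      rw [hB, Set.Finite.mem_toFinset] at hG
      rw [hG.1]
    rw [Finset.sum_congr rfl h1, Finset.sum_const, nsmul_eq_mul,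
      Set.ncard_eq_toFinset_card _ (Set.toFinite _)]
  rw [hBc]
  calc ∑ G ∈ B, y ^ G.edgeSet.ncard
      ≤ ∑ G ∈ (Finset.univ.filter fun ζ => IsBalanced δ ζ).biUnion F, y ^ G.edgeSet.ncard :=
        Finset.sum_le_sum_of_subset_of_nonneg hsub fun _ _ _ => by positivity
    _ ≤ ∑ ζ ∈ Finset.univ.filter fun ζ => IsBalanced δ ζ, ∑ G ∈ F ζ, y ^ G.edgeSet.ncard :=
        sum_biUnion_le _ _ fun _ => by positivity
    _ ≤ ∑ ζ ∈ Finset.univ.filter fun ζ => IsBalanced δ ζ, A * q ^ (colorClass ζ 0).card :=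
        Finset.sum_le_sum hζ
    _ ≤ ∑ ζ, A * q ^ (colorClass ζ 0).card :=
        Finset.sum_le_sum_of_subset_of_nonneg (Finset.filter_subset _ _)
          fun _ _ _ => by positivity
    _ = _ := by rw [← Finset.mul_sum, sum_pow_card_colorClass_zero]

/-- The exponential growth rate of the bound for the expected number of covers. -/
noncomputable def coverRate (k : ℕ) (d L θ κ : ℝ) : ℝ :=
  Real.log (k + jokerRate k L (1 / Real.log k ^ 3) θ (Real.log k ^ 9)) -
    κ * ((k - Real.log k ^ 9 - 1) * (k - Real.log k ^ 9) * (1 - 1 / Real.log k ^ 3) / k) -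
    d / 2 * (1 / k + 1 / (2 * (k : ℝ) ^ 2))

theorem exists_ncard_cover_le {k : ℕ} (hk : 2 ≤ k) {d L δ θ κ : ℝ} (hL : 6 ≤ L)
    (hdL : d = L * (k - 1))
    (hlog : 1 < Real.log k) (hδ : δ ≤ θ) (hθ0 : 0 ≤ θ) (hθ : θ ≤ 1)
    (hrk : 1 ≤ k - Real.log k ^ 9) (hκ0 : 0 ≤ κ)
    (hκ : κ = 0 ∨ κ = stabilityRate L (1 / Real.log k ^ 3)) :
    ∃ (K : ℝ) (p : ℕ), ∀ᶠ n : ℕ in atTop,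
      0 < ({G : SimpleGraph (Fin n) | G.edgeSet.ncard = ⌈d * n / 2⌉₊}.ncard : ℝ) ∧
      ({G : SimpleGraph (Fin n) | G.edgeSet.ncard = ⌈d * n / 2⌉₊ ∧
        ∃ ζ : Fin n → Fin (k + 1), IsCover G ζ ∧ IsBalanced δ ζ}.ncard : ℝ) ≤
      K * ((n : ℝ) ^ p * Real.exp (coverRate k d L θ κ) ^ n) *
        ({G : SimpleGraph (Fin n) | G.edgeSet.ncard = ⌈d * n / 2⌉₊}.ncard : ℝ) := by
  have hk2 : (2 : ℝ) ≤ k := by exact_mod_cast hk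
  have hd : 0 < d := by rw [hdL]; exact mul_pos (by linarith) (by linarith)
  obtain ⟨K, hK, hev⟩ := exists_pow_le_choose hd
  -- The prefactor of the color blocks has degree `4 (k + 1) ^ 2` in `n`; the weak Stirling bound
  -- adds one.
  refine ⟨((Real.exp 1 * 2) ^ 2) ^ ((k + 1) ^ 2) * K, 4 * (k + 1) ^ 2 + 1, ?_⟩
  filter_upwards [hev, eventually_ge_atTop 1] with n hn hn1
  set m := ⌈d * n / 2⌉₊ with hm
  have hn' : (1 : ℝ) ≤ n := by exact_mod_cast hn1
  have hnpos : (0 : ℝ) < n := by linarith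
  set T : ℝ := ({G : SimpleGraph (Fin n) | G.edgeSet.ncard = m}.ncard : ℝ) with hT
  have hTc : ((n.choose 2).choose m : ℝ) ≤ T := by
    rw [hT]; exact_mod_cast choose_le_ncard_edgeSet n m
  have hTK : (n / d : ℝ) ^ m * Real.exp (d * n / 2) ≤ K * n * T := hn.trans (by gcongr)
  have hTpos : 0 < T := by
    have h1 : 0 < K * n * T := lt_of_lt_of_le (by positivity) hTK
    exact pos_of_mul_pos_right h1 (by positivity)
  refine ⟨hTpos, ?_⟩
  have h1 := ncard_cover_mul_pow_le (n := n) (m := m) (by omega) hn1 hL hlog hδ hθ0 hθ hrk hκ0 hκ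
  set X : ℝ := ({G : SimpleGraph (Fin n) | G.edgeSet.ncard = m ∧
        ∃ ζ : Fin n → Fin (k + 1), IsCover G ζ ∧ IsBalanced δ ζ}.ncard : ℝ)
  set q := jokerRate k L (1 / Real.log k ^ 3) θ (Real.log k ^ 9) with hq
  have hq0 : 0 ≤ q := by
    rw [hq, jokerRate]
    have : 0 ≤ Real.log k ^ 9 := by positivity
    positivity
  set S := κ * ((k - Real.log k ^ 9 - 1) * (k - Real.log k ^ 9) * (1 - 1 / Real.log k ^ 3) / k)
    with hS
  rw [← hdL] at h1
  have hy : (0 : ℝ) < (L * k / n) ^ m := by positivity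
  -- Here `d = L (k - 1)` makes the weights match. It also makes `exp (L (k - 1) n / 2)` equal to
  -- the factor `exp (d n / 2)` in the count of all graphs, so only `(1 - 1/k) ^ m` is left.
  have hpow : (1 : ℝ) = (L * k / n) ^ m * ((n / d) ^ m * (1 - 1 / k) ^ m) := by
    rw [← mul_pow, ← mul_pow]
    have hk1 : (k : ℝ) - 1 ≠ 0 := by linarith
    have : L * k / n * (n / d * (1 - 1 / k)) = 1 := by
      rw [hdL]; field_simp
    rw [this, one_pow]
  have hx : (1 - 1 / (k : ℝ)) ^ m ≤ Real.exp (-(n * (d / 2 * (1 / k + 1 / (2 * (k : ℝ) ^ 2))))) := by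
    have h2 : (1 : ℝ) / k < 1 := by rw [div_lt_one (by linarith)]; linarith
    refine (pow_le_pow_left₀ (by linarith) (one_sub_le_exp (by positivity) h2) m).trans ?_
    rw [← Real.exp_nat_mul]
    refine Real.exp_le_exp.2 ?_
    have h3 : d * n / 2 ≤ m := Nat.le_ceil _
    have h4 : (0 : ℝ) ≤ 1 / k + (1 / k) ^ 2 / 2 := by positivity
    have h5 := mul_le_mul_of_nonneg_right h3 h4
    have h6 : d * n / 2 * (1 / (k : ℝ) + (1 / k) ^ 2 / 2) =
      n * (d / 2 * (1 / k + 1 / (2 * (k : ℝ) ^ 2))) := by field_simp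
    linarith
  have hpoly : ((Real.exp 1 * ((n : ℝ) ^ 2 + 1)) ^ 2) ^ ((k + 1) ^ 2) ≤
      ((Real.exp 1 * 2) ^ 2) ^ ((k + 1) ^ 2) * (n : ℝ) ^ (4 * (k + 1) ^ 2) := by
    have : Real.exp 1 * ((n : ℝ) ^ 2 + 1) ≤ Real.exp 1 * 2 * n ^ 2 := by
      rw [mul_assoc]
      gcongr
      nlinarith
    calc _ ≤ ((Real.exp 1 * 2 * (n : ℝ) ^ 2) ^ 2) ^ ((k + 1) ^ 2) := by gcongr
      _ = _ := by rw [mul_pow, mul_pow, ← pow_mul, ← pow_mul, ← pow_mul]; ring_nf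
  have hrate : Real.exp (coverRate k d L θ κ) ^ n = (k + q) ^ n * Real.exp (-(n * S)) *
      Real.exp (-(n * (d / 2 * (1 / k + 1 / (2 * (k : ℝ) ^ 2))))) := by
    rw [coverRate, ← hq, ← hS, ← Real.exp_nat_mul, mul_sub, mul_sub, sub_eq_add_neg,
      sub_eq_add_neg, Real.exp_add, Real.exp_add, Real.exp_nat_mul, Real.exp_log (by positivity)]
  have h2 : X ≤ (((Real.exp 1 * ((n : ℝ) ^ 2 + 1)) ^ 2) ^ ((k + 1) ^ 2) *
      Real.exp (d * n / 2 - n * S) * (k + q) ^ n) * ((n / d) ^ m * (1 - 1 / k) ^ m) := by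
    refine le_of_mul_le_mul_right ?_ hy
    refine h1.trans (le_of_eq ?_)
    rw [mul_assoc _ _ ((L * k / n) ^ m), mul_comm _ ((L * k / n) ^ m), ← hpow, mul_one]
  refine h2.trans ?_
  rw [sub_eq_add_neg, Real.exp_add, hrate]
  calc _ = ((Real.exp 1 * ((n : ℝ) ^ 2 + 1)) ^ 2) ^ ((k + 1) ^ 2) *
        ((n / d : ℝ) ^ m * Real.exp (d * n / 2)) * (1 - 1 / (k : ℝ)) ^ m *
        (Real.exp (-(n * S)) * (k + q) ^ n) := by ring
    _ ≤ ((Real.exp 1 * 2) ^ 2) ^ ((k + 1) ^ 2) * (n : ℝ) ^ (4 * (k + 1) ^ 2) *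
        (K * n * T) * Real.exp (-(n * (d / 2 * (1 / k + 1 / (2 * (k : ℝ) ^ 2))))) *
        (Real.exp (-(n * S)) * (k + q) ^ n) := by
      have : (0 : ℝ) ≤ (1 - 1 / (k : ℝ)) ^ m := by
        refine pow_nonneg ?_ _
        rw [sub_nonneg, div_le_one (by linarith)]
        linarith
      gcongr
    _ = _ := by rw [pow_succ]; ring

/-- For fixed `k` the polynomial factor loses against geometric decay. The number of all graphs is
positive for large `n`, so the default value of `gnmProb` plays no role in the limit. -/
theorem whp_of_coverRate_neg {k : ℕ} (hk : 2 ≤ k) {d L δ θ κ : ℝ} (hL : 6 ≤ L)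
    (hdL : d = L * (k - 1))
    (hlog : 1 < Real.log k) (hδ : δ ≤ θ) (hθ0 : 0 ≤ θ) (hθ : θ ≤ 1)
    (hrk : 1 ≤ k - Real.log k ^ 9) (hκ0 : 0 ≤ κ)
    (hκ : κ = 0 ∨ κ = stabilityRate L (1 / Real.log k ^ 3))
    (hrate : coverRate k d L θ κ < 0) :
    Whp d (fun n G => ¬ ∃ ζ : Fin n → Fin (k + 1), IsCover G ζ ∧ IsBalanced δ ζ) := by
  obtain ⟨K, p, hev⟩ := exists_ncard_cover_le hk hL hdL hlog hδ hθ0 hθ hrk hκ0 hκ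
  set ρ := Real.exp (coverRate k d L θ κ)
  have hρ : ρ < 1 := by rw [← Real.exp_zero]; exact Real.exp_lt_exp.2 hrate
  have hlim : Tendsto (fun n : ℕ => 1 - K * ((n : ℝ) ^ p * ρ ^ n)) atTop (𝓝 1) := by
    have h1 := tendsto_pow_const_mul_const_pow_of_abs_lt_one p
      (show |ρ| < 1 by rwa [abs_of_pos (Real.exp_pos _)])
    simpa using (h1.const_mul K).const_sub 1
  have key : ∀ᶠ n : ℕ in atTop, 1 - K * ((n : ℝ) ^ p * ρ ^ n) ≤
      gnmProb n ⌈d * n / 2⌉₊ (fun G => ¬ ∃ ζ : Fin n → Fin (k + 1),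
        IsCover G ζ ∧ IsBalanced δ ζ) ∧
      gnmProb n ⌈d * n / 2⌉₊ (fun G => ¬ ∃ ζ : Fin n → Fin (k + 1),
        IsCover G ζ ∧ IsBalanced δ ζ) ≤ 1 := by
    filter_upwards [hev] with n hn
    obtain ⟨hT, hX⟩ := hn
    set m := ⌈d * n / 2⌉₊
    set Ts := {G : SimpleGraph (Fin n) | G.edgeSet.ncard = m} with hTs
    set Xs := {G : SimpleGraph (Fin n) | G.edgeSet.ncard = m ∧
        ∃ ζ : Fin n → Fin (k + 1), IsCover G ζ ∧ IsBalanced δ ζ} with hXs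
    have hdiff : {G : SimpleGraph (Fin n) | G.edgeSet.ncard = m ∧
        ¬ ∃ ζ : Fin n → Fin (k + 1), IsCover G ζ ∧ IsBalanced δ ζ} = Ts \ Xs := by
      ext G
      simp only [hTs, hXs, Set.mem_sdiff, Set.mem_ofPred_eq]
      exact ⟨fun h => ⟨h.1, fun h' => h.2 h'.2⟩, fun h => ⟨h.1, fun h' => h.2 ⟨h.1, h'⟩⟩⟩
    have hsub : Xs ⊆ Ts := fun G hG => hG.1
    have hcard : ((Ts \ Xs).ncard : ℝ) + Xs.ncard = Ts.ncard := by
      exact_mod_cast Set.ncard_sdiff_add_ncard_of_subset hsub (Set.toFinite _)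
    rw [gnmProb, hdiff, le_div_iff₀ hT, div_le_one hT]
    have h0 : (0 : ℝ) ≤ Xs.ncard := Nat.cast_nonneg _
    constructor <;> linarith
  exact tendsto_of_tendsto_of_tendsto_of_le_of_le' hlim tendsto_const_nhds
    (key.mono fun n hn => hn.1) (key.mono fun n hn => hn.2)

/-! ### The sign of the growth rate for large `k` -/

theorem coverRate_le {k : ℕ} (hk : 1 ≤ k) {d L θ κ : ℝ} (hL : 0 ≤ L) :
    coverRate k d L θ κ ≤ Real.log k +
      Real.exp L * ((1 + 2 * L) * (k / 2 * Real.exp (-(2 * L * (1 - 1 / Real.log k ^ 3))) +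
        2 * Real.log k ^ 9 * Real.exp (-(2 * L * (1 - θ))))) -
      κ * ((k - Real.log k ^ 9 - 1) * (k - Real.log k ^ 9) * (1 - 1 / Real.log k ^ 3) / k) -
      d / 2 * (1 / k + 1 / (2 * (k : ℝ) ^ 2)) := by
  have hk' : (0 : ℝ) < k := by exact_mod_cast hk
  have hl : 0 ≤ Real.log k := Real.log_natCast_nonneg k
  rw [coverRate]
  have hq : jokerRate k L (1 / Real.log k ^ 3) θ (Real.log k ^ 9) = k * (Real.exp L * ((1 + 2 * L) *
      (k / 2 * Real.exp (-(2 * L * (1 - 1 / Real.log k ^ 3))) +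
        2 * Real.log k ^ 9 * Real.exp (-(2 * L * (1 - θ)))))) := by
    rw [jokerRate]; ring
  rw [hq]
  set X := Real.exp L * ((1 + 2 * L) * (k / 2 * Real.exp (-(2 * L * (1 - 1 / Real.log k ^ 3))) +
        2 * Real.log k ^ 9 * Real.exp (-(2 * L * (1 - θ)))))
  have hX : 0 ≤ X := by positivity
  have h1 : Real.log (k + k * X) ≤ Real.log k + X := by
    rw [show (k : ℝ) + k * X = k * (1 + X) by ring, Real.log_mul hk'.ne' (by positivity)]
    linarith [Real.log_le_sub_one_of_pos (show 0 < 1 + X by positivity)]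
  linarith

/-- The joker term is at most `5`, while the edge term is at least `1.4 ln k`; so `κ = 0` is enough.
-/
theorem coverRate_neg_of_large {k : ℕ} {d L : ℝ} (hl : 1000 ≤ Real.log k)
    (hkl : 14 * Real.log k ^ 12 ≤ Real.exp (Real.log k / 2)) (hL : 3 * Real.log k ≤ L)
    (hd : d = L * (k - 1)) : coverRate k d L (1 / 50) 0 < 0 := by
  have hk : 1 ≤ k := by
    by_contra h
    have : k = 0 := by omega
    rw [this] at hl
    norm_num at hl
  have hk' : (0 : ℝ) < k := by exact_mod_cast hk
  refine (coverRate_le hk (by linarith)).trans_lt ?_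
  have hke : (k : ℝ) = Real.exp (Real.log k) := (Real.exp_log hk').symm
  set l := Real.log k with hldef
  have hl0 : 0 < l := by linarith
  have hL0 : 0 < L := by linarith
  have hk1000 : 1000 ≤ (k : ℝ) := by
    rw [hke]; linarith [Real.add_one_le_exp l]
  have h9 : 2 * l ^ 9 ≤ k / 2 := by
    have h1 : Real.exp (l / 2) ≤ k := by rw [hke]; exact Real.exp_le_exp.2 (by linarith)
    have h2 : l ^ 9 ≤ l ^ 12 := pow_le_pow_right₀ (by linarith) (by norm_num)
    have h3 : 0 ≤ l ^ 12 := by positivity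
    linarith
  have hη : 1 / l ^ 3 ≤ 1 / 50 := by
    refine one_div_le_one_div_of_le (by norm_num) ?_
    calc (50 : ℝ) ≤ l := by linarith
      _ ≤ l ^ 3 := le_self_pow₀ (by linarith) (by norm_num)
  have he : Real.exp (-(2 * L * (1 - 1 / l ^ 3))) ≤ Real.exp (-(2 * L * (1 - 1 / 50))) := by
    refine Real.exp_le_exp.2 ?_
    have : 2 * L * (1 - 1 / 50) ≤ 2 * L * (1 - 1 / l ^ 3) := by gcongr
    linarith
  have hX : Real.exp L * ((1 + 2 * L) * (k / 2 * Real.exp (-(2 * L * (1 - 1 / l ^ 3))) +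
      2 * l ^ 9 * Real.exp (-(2 * L * (1 - 1 / 50))))) ≤ 5 := by
    calc _ ≤ Real.exp L * ((1 + 2 * L) * (k / 2 * Real.exp (-(2 * L * (1 - 1 / 50))) +
      k / 2 * Real.exp (-(2 * L * (1 - 1 / 50))))) := by gcongr
      _ = (1 + 2 * L) * (k * (Real.exp L * Real.exp (-(2 * L * (1 - 1 / 50))))) := by ring
      -- The exponent `2 (1 - 1/50) - 1 = 0.96` is split: `L / 2` absorbs `k`, and `0.46 L` absorbs
      -- `1 + 2 L`.
      _ = (1 + 2 * L) * (k * (Real.exp (-(46 / 100 * L)) * Real.exp (-(L / 2)))) := by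
        rw [← Real.exp_add, ← Real.exp_add]; ring_nf
      _ = ((1 + 2 * L) * Real.exp (-(46 / 100 * L))) * (k * Real.exp (-(L / 2))) := by ring
      _ ≤ 5 * 1 := by
        refine mul_le_mul ?_ ?_ (by positivity) (by norm_num)
        · rw [Real.exp_neg, ← div_eq_mul_inv, div_le_iff₀ (Real.exp_pos _)]
          linarith [Real.add_one_le_exp (46 / 100 * L)]
        · rw [hke, ← Real.exp_add, ← Real.exp_zero]
          exact Real.exp_le_exp.2 (by linarith)
      _ = 5 := by norm_num
  have hD : 14 / 10 * l ≤ d / 2 * (1 / k + 1 / (2 * (k : ℝ) ^ 2)) := by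
    have h1 : d / 2 * (1 / k + 1 / (2 * (k : ℝ) ^ 2)) ≥ d / 2 * (1 / k) := by
      have hd0 : 0 ≤ d := by rw [hd]; exact mul_nonneg hL0.le (by linarith)
      gcongr
      have : (0 : ℝ) ≤ 1 / (2 * (k : ℝ) ^ 2) := by positivity
      linarith
    refine le_trans ?_ h1
    rw [hd, ← div_eq_mul_one_div, le_div_iff₀ hk']
    nlinarith
  rw [zero_mul, sub_zero]
  linarith

/-- The deviation threshold `η = 1 / l ^ 3` is small enough here: since `L ≤ 3 l`, the error `η L ^
2` is at most `9 / l`, negligible against the constant that survives the cancellation with the joker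
term. -/
theorem stabilityRate_ge {l L : ℝ} (hl : 1000 ≤ l) (hle : 14 * l ^ 12 ≤ Real.exp (l / 2))
    (hL1 : 2 * l ≤ L) (hL2 : L ≤ 3 * l) :
    Real.exp (-L) * (1 + L - 10 / l) ≤ stabilityRate L (1 / l ^ 3) := by
  have hl0 : 0 < l := by linarith
  have hL0 : 0 < L := by linarith
  have h1 : 1 / l ^ 3 * L ^ 2 ≤ 9 / l := by
    calc 1 / l ^ 3 * L ^ 2 ≤ 1 / l ^ 3 * (3 * l) ^ 2 := by gcongr
      _ = 9 / l := by field_simp; norm_num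
  have h2 : 4 * L ^ 3 * Real.exp (-L) ≤ 1 / l := by
    have h3 : Real.exp (l / 2) ≤ Real.exp L := Real.exp_le_exp.2 (by linarith)
    rw [Real.exp_neg, ← div_eq_mul_inv, div_le_div_iff₀ (Real.exp_pos L) hl0, one_mul]
    calc 4 * L ^ 3 * l ≤ 4 * (3 * l) ^ 3 * l := by gcongr
      _ = 108 * l ^ 4 := by ring
      _ ≤ 14 * l ^ 8 * l ^ 4 := by
        gcongr
        have : l ≤ l ^ 8 := le_self_pow₀ (by linarith) (by norm_num)
        linarith
      _ = 14 * l ^ 12 := by ring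
      _ ≤ _ := hle.trans h3
  have h3 : stabilityRate L (1 / l ^ 3) = Real.exp (-L) * (1 + L - 1 / l ^ 3 * L ^ 2 -
      4 * L ^ 3 * Real.exp (-L)) := by
    rw [stabilityRate]; ring
  rw [h3]
  have h4 : 10 / l = 9 / l + 1 / l := by ring
  exact mul_le_mul_of_nonneg_left (by linarith) (Real.exp_pos _).le

theorem jokerTerm_le {k l L : ℝ} (hke : k = Real.exp l) (hl : 1000 ≤ l)
    (hkl : 14 * l ^ 12 ≤ Real.exp (l / 2)) (hL1 : 2 * l ≤ L) (hL2 : L ≤ 3 * l) :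
    Real.exp L * ((1 + 2 * L) * (k / 2 * Real.exp (-(2 * L * (1 - 1 / l ^ 3))) +
        2 * l ^ 9 * Real.exp (-(2 * L * (1 - 1 / 50))))) ≤
      k * Real.exp (-L) / 2 * (1 + 2 * L + 84 / l) + 1 / k * (1 / l) := by
  have hl0 : 0 < l := by linarith
  have hl1 : 1 ≤ l := by linarith
  have hL0 : 0 < L := by linarith
  have hk' : 0 < k := by rw [hke]; exact Real.exp_pos _
  have hl2 : 1 / l ^ 2 ≤ 1 / 1000 * (1 / l) := by
    rw [sq, one_div_mul_one_div, one_div_le_one_div (by positivity) (by positivity)]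
    gcongr
  set E := Real.exp (-L) with hE
  have hE0 : 0 < E := Real.exp_pos _
  have hη1 : L * (1 / l ^ 3) ≤ 3 / l ^ 2 := by
    calc L * (1 / l ^ 3) ≤ 3 * l * (1 / l ^ 3) := by gcongr
      _ = _ := by field_simp
  have hA : Real.exp L * ((1 + 2 * L) * (k / 2 * Real.exp (-(2 * L * (1 - 1 / l ^ 3))))) ≤
      k * E / 2 * (1 + 2 * L + 84 / l) := by
    have h1 : Real.exp L * Real.exp (-(2 * L * (1 - 1 / l ^ 3))) =
        E * Real.exp (2 * (L * (1 / l ^ 3))) := by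
      rw [hE, ← Real.exp_add, ← Real.exp_add]; ring_nf
    have h2 : Real.exp (2 * (L * (1 / l ^ 3))) ≤ 1 + 12 * (1 / l ^ 2) := by
      have h3 : 2 * (L * (1 / l ^ 3)) ≤ 6 * (1 / l ^ 2) := by
        have : 3 / l ^ 2 = 3 * (1 / l ^ 2) := by ring
        linarith
      have h4 : 6 * (1 / l ^ 2) ≤ 1 := by
        have : 1 / l ≤ 1 := by rw [div_le_one hl0]; exact hl1
        linarith
      have h5 : (0 : ℝ) ≤ 6 * (1 / l ^ 2) := by positivity
      have h6 := (abs_le.1 (Real.abs_exp_sub_one_sub_id_le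
        (x := 6 * (1 / l ^ 2)) (by rw [abs_of_nonneg h5]; exact h4))).2
      have h7 := Real.exp_le_exp.2 h3
      nlinarith
    calc _ = k / 2 * ((1 + 2 * L) *
          (Real.exp L * Real.exp (-(2 * L * (1 - 1 / l ^ 3))))) := by ring
      _ = k * E / 2 * ((1 + 2 * L) * Real.exp (2 * (L * (1 / l ^ 3)))) := by rw [h1]; ring
      _ ≤ k * E / 2 * ((1 + 2 * L) * (1 + 12 * (1 / l ^ 2))) := by gcongr
      _ ≤ _ := by
        gcongr
        have h8 : (1 + 2 * L) * (12 * (1 / l ^ 2)) ≤ 7 * l * (12 * (1 / l ^ 2)) := by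
          gcongr; linarith
        have h9 : 7 * l * (12 * (1 / l ^ 2)) = 84 / l := by field_simp; norm_num
        linarith
  have hB : Real.exp L * ((1 + 2 * L) * (2 * l ^ 9 * Real.exp (-(2 * L * (1 - 1 / 50))))) ≤
      1 / k * (1 / l) := by
    -- `0.96 L ≥ 1.92 l ≥ l + l / 2`; the spare `exp (-l / 2)` absorbs the powers of `l`.
    have h1 : Real.exp L * Real.exp (-(2 * L * (1 - 1 / 50))) ≤ 1 / k * Real.exp (-(l / 2)) := by
      rw [one_div (k : ℝ), hke, ← Real.exp_neg, ← Real.exp_add, ← Real.exp_add]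
      exact Real.exp_le_exp.2 (by linarith)
    calc _ = 2 * l ^ 9 * (1 + 2 * L) *
          (Real.exp L * Real.exp (-(2 * L * (1 - 1 / 50)))) := by ring
      _ ≤ 2 * l ^ 9 * (7 * l) * (1 / k * Real.exp (-(l / 2))) := by
        gcongr; linarith
      _ = 1 / k * (14 * l ^ 10 * Real.exp (-(l / 2))) := by ring
      _ ≤ 1 / k * (1 / l) := by
        gcongr
        rw [Real.exp_neg, ← div_eq_mul_inv, div_le_div_iff₀ (Real.exp_pos _) hl0, one_mul]
        refine le_trans ?_ hkl
        calc 14 * l ^ 10 * l = 14 * l ^ 11 := by ring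
          _ ≤ 14 * l ^ 12 := by gcongr; norm_num
  rw [mul_add, mul_add]
  exact add_le_add hA hB

/-- Discarding `l ^ 9` of the `k` colors and shrinking the classes by `1 - l ^ (-3)` changes the
main term only by a relative `2 / l ^ 3`, hence by at most `1 / l` inside the bracket. -/
theorem stabilityTerm_ge {k l L κ : ℝ} (hke : k = Real.exp l) (hl : 1000 ≤ l)
    (hkl : 14 * l ^ 12 ≤ Real.exp (l / 2)) (hL1 : 2 * l ≤ L) (hL2 : L ≤ 3 * l)
    (hκ : Real.exp (-L) * (1 + L - 10 / l) ≤ κ) :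
    k * Real.exp (-L) * (1 + L - 11 / l) ≤
      κ * ((k - l ^ 9 - 1) * (k - l ^ 9) * (1 - 1 / l ^ 3) / k) := by
  have hl0 : 0 < l := by linarith
  have hl1 : 1 ≤ l := by linarith
  have hL0 : 0 < L := by linarith
  have hk' : 0 < k := by rw [hke]; exact Real.exp_pos _
  have hl2 : 1 / l ^ 2 ≤ 1 / 1000 * (1 / l) := by
    rw [sq, one_div_mul_one_div, one_div_le_one_div (by positivity) (by positivity)]
    gcongr
  set E := Real.exp (-L) with hE
  have hE0 : 0 < E := Real.exp_pos _
  have hhalf : Real.exp (l / 2) ≤ k := by rw [hke]; exact Real.exp_le_exp.2 (by linarith)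
  have hk12 : 14 * l ^ 12 ≤ k := hkl.trans hhalf
  have h10l : 10 / l ≤ 1 := by rw [div_le_one hl0]; linarith
  have hκ0 : 0 ≤ κ := le_trans (mul_nonneg hE0.le (by linarith)) hκ
  have hl3 : 1 / l ^ 3 ≤ 1 := by
    rw [div_le_one (by positivity)]; exact one_le_pow₀ hl1
  have h1 : (k : ℝ) * (1 - 1 / l ^ 3) ≤ (k - l ^ 9 - 1) * (k - l ^ 9) / k := by
    rw [le_div_iff₀ hk']
    have h2 : 2 * l ^ 9 + 1 ≤ k * (1 / l ^ 3) := by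
      rw [mul_one_div, le_div_iff₀ (by positivity)]
      refine le_trans ?_ hk12
      have : l ^ 3 ≤ l ^ 12 := pow_le_pow_right₀ hl1 (by norm_num)
      nlinarith [pow_nonneg hl0.le 12]
    have h3 : 0 ≤ l ^ 9 := by positivity
    nlinarith
  have h2 : (k : ℝ) * (1 - 2 / l ^ 3) ≤ (k - l ^ 9 - 1) * (k - l ^ 9) * (1 - 1 / l ^ 3) / k := by
    have h3 := mul_le_mul_of_nonneg_right h1 (show 0 ≤ 1 - 1 / l ^ 3 by linarith)
    have h4 : (k : ℝ) * (1 - 2 / l ^ 3) ≤ k * (1 - 1 / l ^ 3) * (1 - 1 / l ^ 3) := by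
      have : k * (1 - 1 / l ^ 3) * (1 - 1 / l ^ 3) =
        (k : ℝ) * (1 - 2 / l ^ 3) + k * (1 / l ^ 3) ^ 2 := by ring
      rw [this]
      have : 0 ≤ k * (1 / l ^ 3) ^ 2 := by positivity
      linarith
    refine h4.trans (h3.trans (le_of_eq (by ring)))
  have h3 : 1 + L - 11 / l ≤ (1 + L - 10 / l) * (1 - 2 / l ^ 3) := by
    have h4 : (1 + L - 10 / l) * (2 / l ^ 3) ≤ (4 * l) * (2 / l ^ 3) := by
      gcongr
      have : 0 ≤ 10 / l := by positivity
      linarith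
    have h5 : (4 * l) * (2 / l ^ 3) = 8 * (1 / l ^ 2) := by field_simp; norm_num
    have h6 : 11 / l = 10 / l + 1 / l := by ring
    have h7 : 0 < 1 / l := by positivity
    rw [mul_sub, mul_one]
    linarith
  have h4 : 0 ≤ 1 - 2 / l ^ 3 := by
    rw [sub_nonneg, div_le_one (by positivity)]
    have : l ≤ l ^ 3 := le_self_pow₀ hl1 (by norm_num)
    linarith
  calc k * E * (1 + L - 11 / l) ≤ k * E * ((1 + L - 10 / l) * (1 - 2 / l ^ 3)) := by gcongr
    _ = (E * (1 + L - 10 / l)) * (k * (1 - 2 / l ^ 3)) := by ring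
    _ ≤ κ * (k * (1 - 2 / l ^ 3)) := by
      exact mul_le_mul_of_nonneg_right hκ (by positivity)
    _ ≤ _ := by gcongr

/-- The errors are at most `56 / l + e / 800`, whereas `e / 2` is at least `100 / l`. -/
theorem remainder_neg {k l e : ℝ} (hl : 1000 ≤ l) (hk : 1000 ≤ k) (hkl : 14 * l ^ 12 ≤ k)
    (he : 200 / l ≤ e) :
    (l - 1 + e) / (k - 1) / 2 + 54 * (1 / l) - e / 2 + (l + 1 - e) / (4 * k) < 0 := by
  have hl0 : 0 < l := by linarith
  have hl1 : 1 ≤ l := by linarith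
  have hk0 : 0 < k := by linarith
  have hk1 : 0 < k - 1 := by linarith
  have hli : 0 < 1 / l := by positivity
  have he0 : 0 < e := lt_of_lt_of_le (by positivity) he
  have hlk : l / k ≤ 1 / l := by
    rw [div_le_div_iff₀ hk0 hl0, one_mul, ← sq]
    have h1 : l ^ 2 ≤ l ^ 12 := pow_le_pow_right₀ hl1 (by norm_num)
    have h2 : 0 ≤ l ^ 12 := by positivity
    linarith
  have h1 : (l - 1 + e) / (k - 1) ≤ 2 * (l / k) + e / 400 := by
    rw [div_le_iff₀ hk1]
    have h2 : l ≤ 2 * (l / k) * (k - 1) := by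
      have : 2 * (l / k) * (k - 1) = l + l * (k - 2) / k := by field_simp; ring
      rw [this]
      have : 0 ≤ l * (k - 2) / k := div_nonneg (mul_nonneg hl0.le (by linarith)) hk0.le
      linarith
    have h3 : e ≤ e / 400 * (k - 1) := by nlinarith
    rw [add_mul]
    linarith
  have h2 : (l + 1 - e) / (4 * k) ≤ l / k := by
    calc (l + 1 - e) / (4 * k) ≤ 4 * l / (4 * k) := by gcongr; linarith
      _ = l / k := by field_simp
  have h3 : 200 / l = 200 * (1 / l) := by ring
  linarith

/-- The critical range. All terms are compared at scale `1/k`: the `ln k` terms cancel, the `1/(2k)`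
left by the edge term meets `-k exp (-L) / 2`, and `-e/(2k)` decides the sign. -/
theorem coverRate_neg_of_near {k : ℕ} {d L e : ℝ} (hl : 1000 ≤ Real.log k)
    (hkl : 14 * Real.log k ^ 12 ≤ Real.exp (Real.log k / 2)) (hL1 : 2 * Real.log k ≤ L)
    (hL2 : L ≤ 3 * Real.log k) (hd : d = L * (k - 1))
    (hde : d = 2 * k * Real.log k - Real.log k - 1 + e) (he : 200 / Real.log k ≤ e) :
    coverRate k d L (1 / 50) (stabilityRate L (1 / Real.log k ^ 3)) < 0 := by
  have hk : 1 ≤ k := by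
    by_contra h
    have : k = 0 := by omega
    rw [this] at hl
    norm_num at hl
  have hk' : (0 : ℝ) < k := by exact_mod_cast hk
  refine (coverRate_le hk (by linarith)).trans_lt ?_
  have hke : (k : ℝ) = Real.exp (Real.log k) := (Real.exp_log hk').symm
  have hκ := stabilityRate_ge hl hkl hL1 hL2
  set κ := stabilityRate L (1 / Real.log k ^ 3)
  set l := Real.log k with hldef
  have hl0 : 0 < l := by linarith
  have hl1 : 1 ≤ l := by linarith
  have hL0 : 0 < L := by linarith
  have hhalf : Real.exp (l / 2) ≤ k := by rw [hke]; exact Real.exp_le_exp.2 (by linarith)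
  have hk12 : 14 * l ^ 12 ≤ k := hkl.trans hhalf
  have hk1000 : 1000 ≤ (k : ℝ) := by
    rw [hke]; linarith [Real.add_one_le_exp l]
  have hli : 0 < 1 / l := by positivity
  set E := Real.exp (-L) with hE
  have hE0 : 0 < E := Real.exp_pos _
  have hkk : Real.exp (-(2 * l)) = 1 / (k : ℝ) ^ 2 := by
    rw [Real.exp_neg, one_div, hke, ← Real.exp_nat_mul]
    push_cast; rfl
  have hEk : E ≤ 1 / (k : ℝ) ^ 2 := by
    rw [← hkk]; exact Real.exp_le_exp.2 (by linarith)
  have hkE : k * E ≤ 1 / k := by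
    calc k * E ≤ k * (1 / (k : ℝ) ^ 2) := by gcongr
      _ = 1 / k := by field_simp
  have hJ := jokerTerm_le hke hl hkl hL1 hL2
  have hS := stabilityTerm_ge hke hl hkl hL1 hL2 hκ
  -- The terms in `L` cancel; `53 = 84 / 2 + 11`, and the exceptional colors later raise it to `54`.
  have hcomb : k * E / 2 * (1 + 2 * L + 84 / l) - k * E * (1 + L - 11 / l) ≤
      -(k * E / 2) + 53 * (1 / k * (1 / l)) := by
    have h1 : k * E * (1 / l) ≤ 1 / k * (1 / l) := by gcongr
    have h2 : k * E / 2 * (1 + 2 * L + 84 / l) - k * E * (1 + L - 11 / l) =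
      -(k * E / 2) + 53 * (k * E * (1 / l)) := by ring
    rw [h2]; linarith
  have he0 : 0 < e := lt_of_lt_of_le (by positivity) he
  have hk1 : (0 : ℝ) < k - 1 := by linarith
  -- The excess of `L` over `2 l`; it enters through `exp (-L) ≥ (1 - u) / k ^ 2`.
  set u := (l - 1 + e) / (k - 1) with hu
  have hLu : L = 2 * l + u := by
    rw [hu, ← sub_eq_iff_eq_add', eq_div_iff hk1.ne']
    linarith
  have hElow : (1 - u) / (2 * k) ≤ k * E / 2 := by
    have h1 : 1 / (k : ℝ) ^ 2 * (1 - u) ≤ E := by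
      rw [hE, hLu, neg_add, Real.exp_add, hkk]
      gcongr
      linarith [Real.add_one_le_exp (-u)]
    calc (1 - u) / (2 * k) = k * (1 / (k : ℝ) ^ 2 * (1 - u)) / 2 := by field_simp
      _ ≤ _ := by gcongr
  have hD : d / 2 * (1 / k + 1 / (2 * (k : ℝ) ^ 2)) =
      l - 1 / k * (1 / 2) + 1 / k * (e / 2) - 1 / k * ((l + 1 - e) / (4 * k)) := by
    rw [hde]; field_simp; ring
  have hfin : u / 2 + 54 * (1 / l) - e / 2 + (l + 1 - e) / (4 * k) < 0 :=
    remainder_neg hl hk1000 hk12 he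
  have hfin' := mul_neg_of_pos_of_neg (show 0 < 1 / (k : ℝ) by positivity) hfin
  have hu' : (1 - u) / (2 * k) = 1 / k * ((1 - u) / 2) := by field_simp
  rw [hD]
  rw [hu'] at hElow
  have hexpand : 1 / (k : ℝ) * (u / 2 + 54 * (1 / l) - e / 2 + (l + 1 - e) / (4 * k)) =
      1 / k * (1 / 2) - 1 / k * ((1 - u) / 2) + 54 * (1 / k * (1 / l)) - 1 / k * (e / 2) +
        1 / k * ((l + 1 - e) / (4 * k)) := by ring
  rw [hexpand] at hfin'
  linarith

end ColorCover

/-! ### Conclusion -/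

theorem mainTheorem3 :
    ∃ ε : ℕ → ℝ, Tendsto ε atTop (𝓝 0) ∧
      ∀ δ : ℕ → ℝ, Tendsto δ atTop (𝓝 0) →
        ∃ k₀ : ℕ, ∀ k : ℕ, k₀ ≤ k → ∀ d : ℝ,
          2 * k * Real.log k - Real.log k - 1 + ε k ≤ d →
            ColorCover.Whp d (fun n G =>
              ¬ ∃ ζ : Fin n → Fin (k + 1),
                ColorCover.IsCover G ζ ∧ ColorCover.IsBalanced (δ k) ζ) := by
  have hlog : Tendsto (fun k : ℕ => Real.log k) atTop atTop :=
    Real.tendsto_log_atTop.comp tendsto_natCast_atTop_atTop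
  -- The errors in the rate are of order `1 / (k ln k)`, so `ε` of order `1 / ln k` suffices; `200`
  -- is what `remainder_neg` asks for.
  refine ⟨fun k => 200 / Real.log k, hlog.const_div_atTop 200, fun δ hδ => ?_⟩
  have h1 : ∀ᶠ k : ℕ in atTop, δ k ≤ 1 / 50 :=
    (hδ.eventually_lt_const (show (0 : ℝ) < 1 / 50 by norm_num)).mono fun _ h => h.le
  have h2 : ∀ᶠ k : ℕ in atTop, 1000 ≤ Real.log k := hlog.eventually_ge_atTop 1000
  have h3 : ∀ᶠ k : ℕ in atTop, 14 * Real.log k ^ 12 ≤ Real.exp (Real.log k / 2) := by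
    have h4 : ∀ᶠ x : ℝ in atTop, 14 * 2 ^ 12 ≤ Real.exp x / x ^ 12 :=
      (Real.tendsto_exp_div_pow_atTop 12).eventually_ge_atTop _
    have h5 : Tendsto (fun k : ℕ => Real.log k / 2) atTop atTop := hlog.atTop_div_const (by norm_num)
    filter_upwards [h5.eventually h4, h2] with k hk hk2
    rw [le_div_iff₀ (by positivity)] at hk
    refine le_trans (le_of_eq ?_) hk
    ring
  obtain ⟨k₀, hk₀⟩ := eventually_atTop.1 (h1.and (h2.and h3))
  refine ⟨k₀, fun k hk d hd => ?_⟩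
  obtain ⟨hδk, hl, hkl⟩ := hk₀ k hk
  have hl0 : 0 < Real.log k := by linarith
  have hk0 : (0 : ℝ) < k := by
    rcases Nat.eq_zero_or_pos k with h | h
    · rw [h] at hl0; simp at hl0
    · exact_mod_cast h
  have hke : (k : ℝ) = Real.exp (Real.log k) := (Real.exp_log hk0).symm
  have hk1000 : 1000 ≤ (k : ℝ) := by rw [hke]; linarith [Real.add_one_le_exp (Real.log k)]
  have hk2 : 2 ≤ k := by
    have : (2 : ℝ) ≤ k := by linarith
    exact_mod_cast this
  have hrk : 1 ≤ k - Real.log k ^ 9 := by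
    have e1 : Real.exp (Real.log k / 2) ≤ k := by
      conv_rhs => rw [hke]
      exact Real.exp_le_exp.2 (by linarith)
    have e2 : Real.log k ^ 9 ≤ Real.log k ^ 12 := pow_le_pow_right₀ (by linarith) (by norm_num)
    have e3 : 1 ≤ Real.log k ^ 12 := one_le_pow₀ (by linarith)
    linarith
  have hk1 : (0 : ℝ) < k - 1 := by linarith
  set L := d / (k - 1) with hL
  have hdL : d = L * (k - 1) := by rw [hL]; field_simp
  -- The excess `d - 2 (k - 1) ln k` is at least `ln k - 1 + ε k`, which is positive.
  have hL2 : 2 * Real.log k ≤ L := by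
    rw [hL, le_div_iff₀ hk1]
    have : 0 < 200 / Real.log k := by positivity
    linarith
  have hL6 : 6 ≤ L := by linarith
  -- Since `d` is not bounded above, the stability estimate, which needs `L = O(ln k)`, is used only
  -- up to `3 ln k`.
  rcases le_total L (3 * Real.log k) with hL3 | hL3
  · have hκ := ColorCover.stabilityRate_ge hl hkl hL2 hL3
    have h10 : 10 / Real.log k ≤ 1 := by rw [div_le_one hl0]; linarith
    refine ColorCover.whp_of_coverRate_neg hk2 hL6 hdL (by linarith) hδk (by norm_num)
      (by norm_num) hrk (le_trans (mul_nonneg (Real.exp_pos _).le (by linarith)) hκ) (Or.inr rfl) ?_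
    exact ColorCover.coverRate_neg_of_near hl hkl hL2 hL3 hdL
      (e := d - (2 * k * Real.log k - Real.log k - 1)) (by ring) (by linarith)
  · exact ColorCover.whp_of_coverRate_neg hk2 hL6 hdL (by linarith) hδk (by norm_num)
      (by norm_num) hrk le_rfl (Or.inl rfl) (ColorCover.coverRate_neg_of_large hl hkl hL3 hdL)
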